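/- Let $M$ be a smooth (Hausdorff) finite-dimensional manifold with a regular Poisson structure $w$, i.e. a smooth Poisson bivector field of constant rank, and let $\sharp_w : T^*M \to TM$ be given by $\beta(\sharp_w\alpha) = w(\alpha,\beta)$. Let $\nabla$ be a Poisson connection on $(M,w)$, i.e. a smooth torsion-free linear connection on $M$ with $\nabla w = 0$, with curvature $R_\nabla(X,Y)Z = \nabla_X\nabla_Y Z - \nabla_Y\nabla_X Z - \nabla_{[X,Y]}Z$. In canonical coordinates $(x^i,p_i)$ of $T^*M$ let $\frac{\delta}{\delta x^i} = \frac{\partial}{\partial x^i} + p_k\Gamma^k_{ij}\frac{\partial}{\partial p_j}$, where $\Gamma^k_{ij}$ are the coefficients of $\nabla$; this is the horizontal lift of $\frac{\partial}{\partial x^i}$ with respect to $\nabla$. Let $$w^H = \tfrac12\, w^{ij}(x)\,\frac{\delta}{\delta x^i}\wedge\frac{\delta}{\delta x^j}$$ be the horizontal lift of $w$, a bivector field on $T^*M$, and let $W_0 = \frac{\partial}{\partial p_i}\wedge\frac{\partial}{\partial x^i}$ be the canonical Poisson structure of $T^*M$, determined by the symplectic form $\omega = dp_i\wedge dx^i$.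 Then $w^H$ is a Poisson structure on $T^*M$ that is compatible with $W_0$ (i.e. the Schouten–Nijenhuis bracket $[w^H, W_0]$ vanishes) if and only if for every smooth 1-form $\alpha$ on $M$ the $TM$-valued 2-form $$(X,Y) \longmapsto R_\nabla(X,Y)(\sharp_w\alpha), \qquad X, Y \text{ smooth vector fields on } M,$$ vanishes. -/

import Mathlib

open Bundle
open scoped Manifold ContDiff Topology

noncomputable section

section Bivector

variable {F : Type*} [NormedAddCommGroup F] [NormedSpace ℝ F]
  {H : Type*} [TopologicalSpace H] {J : ModelWithCorners ℝ F H}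
  {N : Type*} [TopologicalSpace N] [ChartedSpace H N]

/-- A (not necessarily continuous) section `α` of the cotangent bundle is smooth at `x`. -/
def SmoothOneFormAt [IsManifold J ∞ N] (α : ∀ y : N, TangentSpace J y →L[ℝ] ℝ) (x : N) : Prop :=
  ContMDiffAt J (J.prod 𝓘(ℝ, F →L[ℝ] ℝ)) ∞
    (fun y ↦ TotalSpace.mk' (F →L[ℝ] ℝ) (E := fun y : N ↦ TangentSpace J y →L[ℝ] ℝ) y (α y)) x

/-- Smooth vector fields. -/
def IsSmoothVectorField [IsManifold J ∞ N] (X : ∀ y : N, TangentSpace J y) : Prop :=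
  ContMDiff J (J.prod 𝓘(ℝ, F)) ∞ (fun y ↦ TotalSpace.mk' F y (X y))

variable (J N) in
/-- Fields of bilinear forms on the cotangent spaces, i.e. (in finite dimension) contravariant
tensor fields of order two; those that are bivector fields are singled out below. -/
abbrev ContravariantTwoTensor : Type _ :=
  ∀ x : N, (TangentSpace J x →L[ℝ] ℝ) →L[ℝ] (TangentSpace J x →L[ℝ] ℝ) →L[ℝ] ℝ

/-- `P` is a smooth bivector field: it is skew-symmetric, and `P(α, β)` is smooth
wherever the 1-forms `α` and `β` are. -/
structure IsBivectorField [IsManifold J ∞ N] (P : ContravariantTwoTensor J N) : Prop where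
  smooth : ∀ (α β : ∀ y : N, TangentSpace J y →L[ℝ] ℝ) (x : N),
    SmoothOneFormAt α x → SmoothOneFormAt β x →
      ContMDiffAt J 𝓘(ℝ, ℝ) ∞ (fun y ↦ P y (α y) (β y)) x
  skew : ∀ (x : N) (α β : TangentSpace J x →L[ℝ] ℝ), P x α β = -P x β α

/-- `{f, g}_P = P(df, dg)`. -/
def poissonBracket (P : ContravariantTwoTensor J N) (f g : N → ℝ) (x : N) : ℝ :=
  P x (mvfderiv J f x) (mvfderiv J g x)

/-- `P` is a Poisson structure: a smooth bivector field whose bracket satisfies the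
Jacobi identity. -/
structure IsPoisson [IsManifold J ∞ N] (P : ContravariantTwoTensor J N) : Prop where
  isBivectorField : IsBivectorField P
  jacobi : ∀ f g h : N → ℝ, ContMDiff J 𝓘(ℝ, ℝ) ∞ f → ContMDiff J 𝓘(ℝ, ℝ) ∞ g →
    ContMDiff J 𝓘(ℝ, ℝ) ∞ h → ∀ x : N,
      poissonBracket P (poissonBracket P f g) h x + poissonBracket P (poissonBracket P g h) f x
        + poissonBracket P (poissonBracket P h f) g x = 0

/-- The value on `(df, dg, dh)` of the Schouten-Nijenhuis bracket `[P, Q]` of two bivector fields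
(up to the overall sign, which depends on conventions). -/
def schoutenBracket (P Q : ContravariantTwoTensor J N) (f g h : N → ℝ) (x : N) : ℝ :=
  poissonBracket Q (poissonBracket P f g) h x + poissonBracket Q (poissonBracket P g h) f x
    + poissonBracket Q (poissonBracket P h f) g x
    + poissonBracket P (poissonBracket Q f g) h x + poissonBracket P (poissonBracket Q g h) f x
    + poissonBracket P (poissonBracket Q h f) g x

/-- Two Poisson structures are compatible if `[P, Q] = 0`, i.e. if `P + Q` is again Poisson. -/
def AreCompatible (P Q : ContravariantTwoTensor J N) : Prop :=
  ∀ f g h : N → ℝ, ContMDiff J 𝓘(ℝ, ℝ) ∞ f → ContMDiff J 𝓘(ℝ, ℝ) ∞ g →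
    ContMDiff J 𝓘(ℝ, ℝ) ∞ h → ∀ x : N, schoutenBracket P Q f g h x = 0

/-- `P` is regular: its rank is the same at all points. -/
def IsRegularBivector (P : ContravariantTwoTensor J N) : Prop :=
  ∀ x y : N, Module.finrank ℝ (P x).range = Module.finrank ℝ (P y).range

/-- The vector `♯_P α`, determined by `β(♯_P α) = P(α, β)` for all `β`; see `apply_sharp`. -/
def bivectorSharp [FiniteDimensional ℝ F] (P : ContravariantTwoTensor J N) (x : N)
    (α : TangentSpace J x →L[ℝ] ℝ) : TangentSpace J x :=
  haveI : FiniteDimensional ℝ (TangentSpace J x) := inferInstanceAs (FiniteDimensional ℝ F)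
  haveI : T2Space (TangentSpace J x) := inferInstanceAs (T2Space F)
  (Module.evalEquiv ℝ (TangentSpace J x)).symm
    ((P x α).toLinearMap ∘ₗ
      (LinearMap.toContinuousLinearMap :
        (TangentSpace J x →ₗ[ℝ] ℝ) ≃ₗ[ℝ] (TangentSpace J x →L[ℝ] ℝ)).toLinearMap)

theorem apply_sharp [FiniteDimensional ℝ F] (P : ContravariantTwoTensor J N) (x : N)
    (α β : TangentSpace J x →L[ℝ] ℝ) : β (bivectorSharp P x α) = P x α β := by
  have : FiniteDimensional ℝ (TangentSpace J x) := inferInstanceAs (FiniteDimensional ℝ F)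
  have : T2Space (TangentSpace J x) := inferInstanceAs (T2Space F)
  exact Module.apply_evalEquiv_symm_apply ℝ (TangentSpace J x) β.toLinearMap
    ((P x α).toLinearMap ∘ₗ
      (LinearMap.toContinuousLinearMap :
        (TangentSpace J x →ₗ[ℝ] ℝ) ≃ₗ[ℝ] (TangentSpace J x →L[ℝ] ℝ)).toLinearMap)

end Bivector

section Connection

variable {E : Type*} [NormedAddCommGroup E] [NormedSpace ℝ E]
  {M : Type*} [TopologicalSpace M] [ChartedSpace E M] [IsManifold 𝓘(ℝ, E) ∞ M]

theorem tensorialAt_covDerivOneForm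
    (cov : CovariantDerivative 𝓘(ℝ, E) E (TangentSpace 𝓘(ℝ, E) : M → Type _))
    {α : ∀ y : M, TangentSpace 𝓘(ℝ, E) y →L[ℝ] ℝ} {x : M}
    (hα : MDifferentiableAt 𝓘(ℝ, E) (𝓘(ℝ, E).prod 𝓘(ℝ, E →L[ℝ] ℝ))
      (fun y ↦ TotalSpace.mk' (E →L[ℝ] ℝ)
        (E := fun y : M ↦ TangentSpace 𝓘(ℝ, E) y →L[ℝ] ℝ) y (α y)) x)
    (v : TangentSpace 𝓘(ℝ, E) x) :
    TensorialAt 𝓘(ℝ, E) E (fun Y : ∀ y : M, TangentSpace 𝓘(ℝ, E) y ↦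
      (mvfderiv 𝓘(ℝ, E) (fun y ↦ α y (Y y)) x v - α x (cov Y x v) : ℝ)) x := by
  have key : ∀ {Y : ∀ y : M, TangentSpace 𝓘(ℝ, E) y}, MDiffAt (T% Y) x →
      MDiffAt (fun y ↦ α y (Y y)) x := by
    intro Y hY
    have := hα.clm_bundle_apply (F₁ := E) (F₂ := ℝ) (E₂ := Trivial M ℝ) hY
    rw [mdifferentiableAt_totalSpace] at this
    exact this.2
  constructor
  · intro f Y hf hY
    have h1 : (fun y ↦ α y ((f • Y) y)) = f • (fun y ↦ α y (Y y)) := by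
      ext y; simp
    rw [h1, mvfderiv_smul hf (key hY), cov.isCovariantDerivativeOn.leibniz hY hf]
    simp
    ring
  · intro Y Z hY hZ
    have h1 : (fun y ↦ α y ((Y + Z) y)) = (fun y ↦ α y (Y y)) + (fun y ↦ α y (Z y)) := by
      ext y; simp
    rw [h1, mvfderiv_add (key hY) (key hZ), cov.isCovariantDerivativeOn.add hY hZ]
    simp
    ring

variable [FiniteDimensional ℝ E]

/-- The covariant derivative `∇_v α` of a 1-form `α` differentiable at `x`, for `v ∈ T_x M`:
`(∇_v α)(Y) = v(α(Y)) - α(∇_v Y)`; see `covDerivOneForm_apply`. -/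
def covDerivOneForm (cov : CovariantDerivative 𝓘(ℝ, E) E (TangentSpace 𝓘(ℝ, E) : M → Type _))
    {α : ∀ y : M, TangentSpace 𝓘(ℝ, E) y →L[ℝ] ℝ} {x : M}
    (hα : MDifferentiableAt 𝓘(ℝ, E) (𝓘(ℝ, E).prod 𝓘(ℝ, E →L[ℝ] ℝ))
      (fun y ↦ TotalSpace.mk' (E →L[ℝ] ℝ)
        (E := fun y : M ↦ TangentSpace 𝓘(ℝ, E) y →L[ℝ] ℝ) y (α y)) x)
    (v : TangentSpace 𝓘(ℝ, E) x) : TangentSpace 𝓘(ℝ, E) x →L[ℝ] ℝ :=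
  TensorialAt.mkHom _ x (tensorialAt_covDerivOneForm cov hα v)

theorem covDerivOneForm_apply
    (cov : CovariantDerivative 𝓘(ℝ, E) E (TangentSpace 𝓘(ℝ, E) : M → Type _))
    {α : ∀ y : M, TangentSpace 𝓘(ℝ, E) y →L[ℝ] ℝ} {x : M}
    (hα : MDifferentiableAt 𝓘(ℝ, E) (𝓘(ℝ, E).prod 𝓘(ℝ, E →L[ℝ] ℝ))
      (fun y ↦ TotalSpace.mk' (E →L[ℝ] ℝ)
        (E := fun y : M ↦ TangentSpace 𝓘(ℝ, E) y →L[ℝ] ℝ) y (α y)) x)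
    (v : TangentSpace 𝓘(ℝ, E) x) {Y : ∀ y : M, TangentSpace 𝓘(ℝ, E) y}
    (hY : MDifferentiableAt 𝓘(ℝ, E) (𝓘(ℝ, E).prod 𝓘(ℝ, E)) (fun y ↦ TotalSpace.mk' E y (Y y)) x) :
    covDerivOneForm cov hα v (Y x)
      = mvfderiv 𝓘(ℝ, E) (fun y ↦ α y (Y y)) x v - α x (cov Y x v) :=
  TensorialAt.mkHom_apply (tensorialAt_covDerivOneForm cov hα v) hY

theorem covDerivOneForm_add
    (cov : CovariantDerivative 𝓘(ℝ, E) E (TangentSpace 𝓘(ℝ, E) : M → Type _))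
    {α : ∀ y : M, TangentSpace 𝓘(ℝ, E) y →L[ℝ] ℝ} {x : M}
    (hα : MDifferentiableAt 𝓘(ℝ, E) (𝓘(ℝ, E).prod 𝓘(ℝ, E →L[ℝ] ℝ))
      (fun y ↦ TotalSpace.mk' (E →L[ℝ] ℝ)
        (E := fun y : M ↦ TangentSpace 𝓘(ℝ, E) y →L[ℝ] ℝ) y (α y)) x)
    (u v : TangentSpace 𝓘(ℝ, E) x) :
    covDerivOneForm cov hα (u + v) = covDerivOneForm cov hα u + covDerivOneForm cov hα v := by
  apply ContinuousLinearMap.ext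
  intro Y
  simp only [covDerivOneForm, TensorialAt.mkHom_apply_eq_extend, add_apply, map_add]
  ring

theorem covDerivOneForm_smul
    (cov : CovariantDerivative 𝓘(ℝ, E) E (TangentSpace 𝓘(ℝ, E) : M → Type _))
    {α : ∀ y : M, TangentSpace 𝓘(ℝ, E) y →L[ℝ] ℝ} {x : M}
    (hα : MDifferentiableAt 𝓘(ℝ, E) (𝓘(ℝ, E).prod 𝓘(ℝ, E →L[ℝ] ℝ))
      (fun y ↦ TotalSpace.mk' (E →L[ℝ] ℝ)
        (E := fun y : M ↦ TangentSpace 𝓘(ℝ, E) y →L[ℝ] ℝ) y (α y)) x)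
    (c : ℝ) (v : TangentSpace 𝓘(ℝ, E) x) :
    covDerivOneForm cov hα (c • v) = c • covDerivOneForm cov hα v := by
  apply ContinuousLinearMap.ext
  intro Y
  simp only [covDerivOneForm, TensorialAt.mkHom_apply_eq_extend, smul_apply, map_smul, smul_eq_mul]
  ring

/-- `∇` is a Poisson connection for `w`: a smooth symmetric (torsion-free) linear connection
with `∇w = 0`, where `(∇_v w)(α, β) = v(w(α, β)) - w(∇_v α, β) - w(α, ∇_v β)`. -/
structure IsPoissonConnection
    (cov : CovariantDerivative 𝓘(ℝ, E) E (TangentSpace 𝓘(ℝ, E) : M → Type _))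
    (w : ContravariantTwoTensor 𝓘(ℝ, E) M) : Prop where
  smooth : CovariantDerivative.ContMDiffCovariantDerivative cov ∞
  torsion_free : cov.torsion = 0
  parallel : ∀ (α β : ∀ y : M, TangentSpace 𝓘(ℝ, E) y →L[ℝ] ℝ) (x : M)
    (hα : SmoothOneFormAt α x) (hβ : SmoothOneFormAt β x) (v : TangentSpace 𝓘(ℝ, E) x),
    mvfderiv 𝓘(ℝ, E) (fun y ↦ w y (α y) (β y)) x v
      - w x (covDerivOneForm cov (hα.mdifferentiableAt (by simp)) v) (β x)
      - w x (α x) (covDerivOneForm cov (hβ.mdifferentiableAt (by simp)) v) = 0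

/-- The curvature `R(X, Y)Z = ∇_X ∇_Y Z - ∇_Y ∇_X Z - ∇_[X, Y] Z`. -/
def connectionCurvature (cov : CovariantDerivative 𝓘(ℝ, E) E (TangentSpace 𝓘(ℝ, E) : M → Type _))
    (X Y Z : ∀ y : M, TangentSpace 𝓘(ℝ, E) y) (x : M) : TangentSpace 𝓘(ℝ, E) x :=
  cov (fun y ↦ cov Z y (Y y)) x (X x) - cov (fun y ↦ cov Z y (X y)) x (Y x)
    - cov Z x (VectorField.mlieBracket 𝓘(ℝ, E) X Y x)

end Connection

section Cotangent

variable {E : Type*} [NormedAddCommGroup E] [NormedSpace ℝ E]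
  {M : Type*} [TopologicalSpace M] [ChartedSpace E M]

variable (E M) in
/-- The cotangent bundle `T*M`, with Mathlib's topology and atlas. -/
abbrev CotangentBundle : Type _ :=
  TotalSpace (E →L[ℝ] ℝ) (fun x : M ↦ TangentSpace 𝓘(ℝ, E) x →L[ℝ] ℝ)

variable (E) in
/-- The model with corners of `T*M`. -/
abbrev cotangentModel : ModelWithCorners ℝ (E × (E →L[ℝ] ℝ)) (ModelProd E (E →L[ℝ] ℝ)) :=
  𝓘(ℝ, E).prod 𝓘(ℝ, E →L[ℝ] ℝ)

variable [IsManifold 𝓘(ℝ, E) ∞ M]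

/- In what follows `T_ξ(T*M)` is identified with `E × E*` through the preferred chart at `ξ`, as
everywhere in Mathlib. The next lemma says that this chart consists of the canonical coordinates
`(x^i, p_i)` belonging to the preferred chart of `M` at the base point of `ξ`. Thus `(v, 0)` is
`v^i ∂/∂x^i` and `(0, a)` is the vertical vector `a_i ∂/∂p_i`. -/
theorem extChartAt_cotangent_apply (ξ η : CotangentBundle E M) :
    extChartAt (cotangentModel E) ξ η =
      (chartAt E ξ.1 η.1,
        η.2.comp ((trivializationAt E (TangentSpace 𝓘(ℝ, E)) ξ.1).symmL ℝ η.1)) := by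
  rw [FiberBundle.extChartAt]
  simp [hom_trivializationAt_apply, ContinuousLinearMap.inCoordinates]

theorem symmL_self (x : M) : (trivializationAt E (TangentSpace 𝓘(ℝ, E)) x).symmL ℝ x = ContinuousLinearMap.id ℝ E := by
    rw [TangentBundle.symmL_trivializationAt (by simp), mfderivWithin_range_extChartAt_symm]
    rfl

variable (x : M) (p : E →L[ℝ] ℝ) in
theorem hasMFDerivAt_fiber_cotangent :
    HasMFDerivAt 𝓘(ℝ, E →L[ℝ] ℝ) (cotangentModel E) (fun a : E →L[ℝ] ℝ ↦ (⟨x, a⟩ : CotangentBundle E M)) p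
      (ContinuousLinearMap.inr ℝ E (E →L[ℝ] ℝ)) := by
  constructor
  · exact (FiberBundle.continuous_totalSpaceMk (E →L[ℝ] ℝ) (fun x : M ↦ TangentSpace 𝓘(ℝ, E) x →L[ℝ] ℝ) x).continuousAt
  · have : writtenInExtChartAt 𝓘(ℝ, E →L[ℝ] ℝ) (cotangentModel E) p (fun a : E →L[ℝ] ℝ ↦ (⟨x, a⟩ : CotangentBundle E M)) = fun a => (chartAt E x x, a) := by
      ext1 a
      simp only [writtenInExtChartAt, Function.comp_def]
      rw [extChartAt_cotangent_apply]
      dsimp only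
      rw [symmL_self]
      rfl
    rw [this]
    exact (hasFDerivAt_prodMk_right _ _).hasFDerivWithinAt

theorem hasMFDerivAt_extend_cotangent (x : M) (p : TangentSpace 𝓘(ℝ, E) x →L[ℝ] ℝ) :
    HasMFDerivAt 𝓘(ℝ, E) (cotangentModel E) (fun y : M ↦ (⟨y, FiberBundle.extend (E →L[ℝ] ℝ) (E := fun x : M ↦ TangentSpace 𝓘(ℝ, E) x →L[ℝ] ℝ) p y⟩ : CotangentBundle E M)) x
      (ContinuousLinearMap.inl ℝ E (E →L[ℝ] ℝ)) := by
  constructor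
  · exact (FiberBundle.mdifferentiableAt_extend 𝓘(ℝ, E) (E →L[ℝ] ℝ) (V := fun x : M ↦ TangentSpace 𝓘(ℝ, E) x →L[ℝ] ℝ) p).continuousAt
  · refine HasFDerivAt.hasFDerivWithinAt ?_
    have : writtenInExtChartAt 𝓘(ℝ, E) (cotangentModel E) x (fun y : M ↦ (⟨y, FiberBundle.extend (E →L[ℝ] ℝ) (E := fun x : M ↦ TangentSpace 𝓘(ℝ, E) x →L[ℝ] ℝ) p y⟩ : CotangentBundle E M))
        =ᶠ[𝓝 (extChartAt 𝓘(ℝ, E) x x)] fun z => (z, p) := by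
      filter_upwards [extChartAt_target_mem_nhds (I := 𝓘(ℝ, E)) x] with z hz
      have hz' : (chartAt E x).symm z ∈ (trivializationAt (E →L[ℝ] ℝ) (fun x : M ↦ TangentSpace 𝓘(ℝ, E) x →L[ℝ] ℝ) x).baseSet := by
        simp only [mfld_simps] at hz
        simp [hz]
      simp only [writtenInExtChartAt, Function.comp_def, FiberBundle.extend_apply_self, FiberBundle.extChartAt, PartialEquiv.trans_apply]
      have h3 : (trivializationAt (E →L[ℝ] ℝ) (fun x : M ↦ TangentSpace 𝓘(ℝ, E) x →L[ℝ] ℝ) x ⟨x, p⟩).2 = p := by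
        rw [hom_trivializationAt_apply]
        simp [ContinuousLinearMap.inCoordinates, symmL_self]
        rfl
      have h4 := (trivializationAt (E →L[ℝ] ℝ) (fun x : M ↦ TangentSpace 𝓘(ℝ, E) x →L[ℝ] ℝ) x).apply_mk_symm hz' p
      simp only [mfld_simps] at hz ⊢
      unfold FiberBundle.extend
      rw [h3]
      erw [h4]
      simp [hz]
    refine HasFDerivAt.congr_of_eventuallyEq ?_ this
    exact hasFDerivAt_prodMk_left _ _

section ExtDeriv

variable {F : Type*} [NormedAddCommGroup F] [NormedSpace ℝ F]
  {H : Type*} [TopologicalSpace H] (J : ModelWithCorners ℝ F H)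
  {N : Type*} [TopologicalSpace N] [ChartedSpace H N]

/-- The 1-form `θ` read in the preferred chart at `x`, i.e. its pullback under the inverse of
that chart. -/
def oneFormInChart (θ : ∀ x : N, TangentSpace J x →L[ℝ] ℝ) (x : N) (z : F) : F →L[ℝ] ℝ :=
  (θ ((extChartAt J x).symm z)).comp
    (mfderivWithin 𝓘(ℝ, F) J (extChartAt J x).symm (Set.range J) z)

/-- The exterior derivative `(dθ)_x(u, v)` of a 1-form, computed in the preferred chart at `x`. -/
def extDerivOneForm (θ : ∀ x : N, TangentSpace J x →L[ℝ] ℝ) (x : N) (u v : TangentSpace J x) : ℝ :=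
  fderivWithin ℝ (oneFormInChart J θ x) (Set.range J) (extChartAt J x x) u v -
    fderivWithin ℝ (oneFormInChart J θ x) (Set.range J) (extChartAt J x x) v u
end ExtDeriv

/-- The Liouville form `λ = p_i dx^i`: `λ_ξ(U) = ξ(dπ U)`. -/
def liouvilleForm (ξ : CotangentBundle E M) : TangentSpace (cotangentModel E) ξ →L[ℝ] ℝ :=
  ξ.2.comp (mfderiv (cotangentModel E) 𝓘(ℝ, E) (TotalSpace.proj : CotangentBundle E M → M) ξ)

theorem liouville_chart (ξ : CotangentBundle E M) {z : E × (E →L[ℝ] ℝ)} (hz : z ∈ (extChartAt (cotangentModel E) ξ).target) :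
    oneFormInChart (cotangentModel E) (liouvilleForm (E := E) (M := M)) ξ z = z.2.comp (ContinuousLinearMap.fst ℝ E (E →L[ℝ] ℝ)) := by
  have h1 := (extChartAt (cotangentModel E) ξ).right_inv hz
  have h2 := (extChartAt (cotangentModel E) ξ).map_target hz
  have hd : MDifferentiableAt 𝓘(ℝ, E × (E →L[ℝ] ℝ)) (cotangentModel E) (extChartAt (cotangentModel E) ξ).symm z := by
    have := mdifferentiableWithinAt_extChartAt_symm (I := cotangentModel E) hz
    simpa only [ModelWithCorners.range_eq_univ, mdifferentiableWithinAt_univ] using this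
  unfold oneFormInChart liouvilleForm
  set η := (extChartAt (cotangentModel E) ξ).symm z with hη
  rw [extChartAt_cotangent_apply] at h1
  have hs : η.1 ∈ (chartAt E ξ.1).source := by
    rw [FiberBundle.extChartAt] at h2
    have := h2.2
    simp only [mfld_simps] at h2
    simpa using h2.1
  have hy : chartAt E ξ.1 η.1 = z.1 := congrArg Prod.fst h1
  have hp : η.2.comp ((trivializationAt E (TangentSpace 𝓘(ℝ, E)) ξ.1).symmL ℝ η.1) = z.2 := congrArg Prod.snd h1
  rw [ModelWithCorners.range_eq_univ, mfderivWithin_univ]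
  have hπ : MDifferentiableAt (cotangentModel E) 𝓘(ℝ, E) (TotalSpace.proj : CotangentBundle E M → M) η :=
    mdifferentiableAt_proj _
  have hc : (mfderiv (cotangentModel E) 𝓘(ℝ, E) (TotalSpace.proj : CotangentBundle E M → M) η).comp
     (mfderiv 𝓘(ℝ, E × (E →L[ℝ] ℝ)) (cotangentModel E) (extChartAt (cotangentModel E) ξ).symm z) = 
     (mfderiv 𝓘(ℝ, E) 𝓘(ℝ, E) (extChartAt 𝓘(ℝ, E) ξ.1).symm z.1).comp (ContinuousLinearMap.fst ℝ E (E →L[ℝ] ℝ)) := by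
    rw [← mfderiv_comp z hπ hd]
    have h5 : (TotalSpace.proj : CotangentBundle E M → M) ∘ (extChartAt (cotangentModel E) ξ).symm
        =ᶠ[𝓝 z] (extChartAt 𝓘(ℝ, E) ξ.1).symm ∘ Prod.fst := by
      have ho : (extChartAt (cotangentModel E) ξ).target ∈ 𝓝 z :=
        (isOpen_extChartAt_target ξ).mem_nhds hz
      filter_upwards [ho] with z' hz'
      have h6 := (extChartAt (cotangentModel E) ξ).right_inv hz'
      have h7 := (extChartAt (cotangentModel E) ξ).map_target hz'
      rw [extChartAt_cotangent_apply] at h6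
      rw [FiberBundle.extChartAt] at h7
      simp only [mfld_simps] at h7
      have h8 : ((extChartAt (cotangentModel E) ξ).symm z').1 ∈ (chartAt E ξ.1).source := by
        rw [FiberBundle.extChartAt]
        simpa only [mfld_simps] using h7.1.1
      have h9 := congrArg Prod.fst h6
      exact ((chartAt E ξ.1).left_inv h8).symm.trans (congrArg (chartAt E ξ.1).symm h9)
    have h10 : MDifferentiableAt 𝓘(ℝ, E) 𝓘(ℝ, E) (extChartAt 𝓘(ℝ, E) ξ.1).symm z.1 := by
      have h11 : z.1 ∈ (extChartAt 𝓘(ℝ, E) ξ.1).target := by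
        rw [← hy]
        simp [hs]
      have := mdifferentiableWithinAt_extChartAt_symm (I := 𝓘(ℝ, E)) h11
      simpa only [ModelWithCorners.range_eq_univ, mdifferentiableWithinAt_univ] using this
    have h12 : HasMFDerivAt 𝓘(ℝ, E × (E →L[ℝ] ℝ)) 𝓘(ℝ, E) (Prod.fst : E × (E →L[ℝ] ℝ) → E) z (ContinuousLinearMap.fst ℝ E (E →L[ℝ] ℝ)) :=
      hasFDerivAt_fst.hasMFDerivAt
    rw [h5.mfderiv_eq, mfderiv_comp z h10 h12.mdifferentiableAt, h12.mfderiv]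
    rfl
  apply ContinuousLinearMap.ext
  intro w
  have hw := DFunLike.congr_fun hc (show TangentSpace 𝓘(ℝ, E × (E →L[ℝ] ℝ)) z from w)
  have hp' : ∀ u : E, η.2 ((trivializationAt E (TangentSpace 𝓘(ℝ, E)) ξ.1).symmL ℝ η.1 u) = z.2 u :=
    fun u => DFunLike.congr_fun hp u
  rw [TangentBundle.symmL_trivializationAt hs, ModelWithCorners.range_eq_univ, mfderivWithin_univ] at hp'
  have hy' : extChartAt 𝓘(ℝ, E) ξ.1 η.1 = z.1 := hy
  rw [hy'] at hp'
  exact (congrArg η.2 hw).trans (hp' w.1)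

/-- The canonical symplectic form `ω = dλ`. -/
def symplecticForm (ξ : CotangentBundle E M) (U V : TangentSpace (cotangentModel E) ξ) : ℝ :=
  extDerivOneForm (cotangentModel E) (liouvilleForm (E := E) (M := M)) ξ U V

set_option maxSynthPendingDepth 3 in
/-- `ω = dp_i ∧ dx^i`. -/
theorem symplecticForm_apply (ξ : CotangentBundle E M) (U V : TangentSpace (cotangentModel E) ξ) :
    symplecticForm ξ U V =
      (show E × (E →L[ℝ] ℝ) from U).2 (show E × (E →L[ℝ] ℝ) from V).1 -
      (show E × (E →L[ℝ] ℝ) from V).2 (show E × (E →L[ℝ] ℝ) from U).1 := by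
  have h : oneFormInChart (cotangentModel E) (liouvilleForm (E := E) (M := M)) ξ
      =ᶠ[𝓝 (extChartAt (cotangentModel E) ξ ξ)]
      fun z => z.2.comp (ContinuousLinearMap.fst ℝ E (E →L[ℝ] ℝ)) := by
    filter_upwards [extChartAt_target_mem_nhds (I := cotangentModel E) ξ] with z hz
    exact liouville_chart ξ hz
  have h2 : HasFDerivAt (fun z : E × (E →L[ℝ] ℝ) => z.2.comp (ContinuousLinearMap.fst ℝ E (E →L[ℝ] ℝ)))
     ((ContinuousLinearMap.precomp ℝ (ContinuousLinearMap.fst ℝ E (E →L[ℝ] ℝ))).comp (ContinuousLinearMap.snd ℝ E (E →L[ℝ] ℝ))) (extChartAt (cotangentModel E) ξ ξ) :=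
    ((ContinuousLinearMap.precomp ℝ (ContinuousLinearMap.fst ℝ E (E →L[ℝ] ℝ))).comp (ContinuousLinearMap.snd ℝ E (E →L[ℝ] ℝ))).hasFDerivAt
  unfold symplecticForm extDerivOneForm
  rw [ModelWithCorners.range_eq_univ, fderivWithin_univ, h.fderiv_eq, h2.fderiv]
  rfl

set_option maxSynthPendingDepth 3 in
variable (E M) in
/-- The canonical Poisson bivector `W_0 = ♯_ω ω = ∂/∂p_i ∧ ∂/∂x^i` of the cotangent bundle:
`W_0(Φ, Ψ) = Φ(∂/∂p_i) Ψ(∂/∂x^i) - Ψ(∂/∂p_i) Φ(∂/∂x^i)`. -/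
def canonicalPoisson : ContravariantTwoTensor (cotangentModel E) (CotangentBundle E M) := fun _ ↦
  let A : (E × (E →L[ℝ] ℝ) →L[ℝ] ℝ) →L[ℝ] (E × (E →L[ℝ] ℝ) →L[ℝ] ℝ) →L[ℝ] ℝ :=
    (ContinuousLinearMap.precomp ℝ
      (ContinuousLinearMap.precomp ℝ (ContinuousLinearMap.inl ℝ E (E →L[ℝ] ℝ)))).comp
      (ContinuousLinearMap.precomp ℝ (ContinuousLinearMap.inr ℝ E (E →L[ℝ] ℝ)))
  A - A.flip

theorem canonicalPoisson_apply (ξ : CotangentBundle E M) (Φ Ψ : E × (E →L[ℝ] ℝ) →L[ℝ] ℝ) :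
    canonicalPoisson E M ξ Φ Ψ =
      Φ (0, Ψ.comp (ContinuousLinearMap.inl ℝ E (E →L[ℝ] ℝ))) -
        Ψ (0, Φ.comp (ContinuousLinearMap.inl ℝ E (E →L[ℝ] ℝ))) := rfl

/-- `W_0(Φ, Ψ) = ω(♯Φ, ♯Ψ)`, where `U = ♯Φ` means `i_U ω = Φ` and `ω = dλ`. -/
theorem canonicalPoisson_eq_symplecticForm (ξ : CotangentBundle E M)
    (Φ Ψ : TangentSpace (cotangentModel E) ξ →L[ℝ] ℝ) (U V : TangentSpace (cotangentModel E) ξ)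
    (hU : ∀ Z, symplecticForm ξ U Z = Φ Z) (hV : ∀ Z, symplecticForm ξ V Z = Ψ Z) :
    canonicalPoisson E M ξ Φ Ψ = symplecticForm ξ U V := by
  simp only [symplecticForm_apply] at hU hV
  have hΦ : Φ.comp (ContinuousLinearMap.inl ℝ E (E →L[ℝ] ℝ)) = (show E × (E →L[ℝ] ℝ) from U).2 := by
    apply ContinuousLinearMap.ext
    intro v
    have h := hU (show E × (E →L[ℝ] ℝ) from (v, 0))
    refine Eq.trans ?_ (h.symm.trans ?_)
    · rfl
    · simp
  have hΨ : Ψ.comp (ContinuousLinearMap.inl ℝ E (E →L[ℝ] ℝ)) = (show E × (E →L[ℝ] ℝ) from V).2 := by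
    apply ContinuousLinearMap.ext
    intro v
    have h := hV (show E × (E →L[ℝ] ℝ) from (v, 0))
    refine Eq.trans ?_ (h.symm.trans ?_)
    · rfl
    · simp
  have h1 := hU (show E × (E →L[ℝ] ℝ) from (0, (show E × (E →L[ℝ] ℝ) from V).2))
  have h2 := hV (show E × (E →L[ℝ] ℝ) from (0, (show E × (E →L[ℝ] ℝ) from U).2))
  have h3 := canonicalPoisson_apply ξ Φ Ψ
  erw [hΦ, hΨ] at h3
  rw [symplecticForm_apply]
  refine h3.trans ?_
  erw [← h1, ← h2]
  simp
  ring

theorem clm_prod_apply_neg {G₁ G₂ G₃ : Type*} [NormedAddCommGroup G₁] [NormedSpace ℝ G₁]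
    [NormedAddCommGroup G₂] [NormedSpace ℝ G₂] [NormedAddCommGroup G₃] [NormedSpace ℝ G₃]
    (D : G₁ × G₂ →L[ℝ] G₃) (v : G₁) (c : G₂) : D (v, -c) = D (v, 0) - D (0, c) := by
  rw [← map_sub]
  simp

theorem hasMFDerivAt_comp_cotangent (x : M) (p : E →L[ℝ] ℝ) {G : Type*} [NormedAddCommGroup G]
    [NormedSpace ℝ G] {K : Type*} [TopologicalSpace K] {L : ModelWithCorners ℝ G K}
    {N : Type*} [TopologicalSpace N] [ChartedSpace K N] {f : CotangentBundle E M → N}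
    (D : E × (E →L[ℝ] ℝ) →L[ℝ] G)
    (hf : HasMFDerivAt (cotangentModel E) L f (⟨x, p⟩ : CotangentBundle E M) D) :
    HasMFDerivAt 𝓘(ℝ, E) L (fun y : M ↦ f ⟨y, FiberBundle.extend (E →L[ℝ] ℝ)
      (E := fun y : M ↦ TangentSpace 𝓘(ℝ, E) y →L[ℝ] ℝ) (x := x) p y⟩) x
        (D.comp (ContinuousLinearMap.inl ℝ E (E →L[ℝ] ℝ))) ∧
    HasMFDerivAt 𝓘(ℝ, E →L[ℝ] ℝ) L (fun a : E →L[ℝ] ℝ ↦ f ⟨x, a⟩) p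
        (D.comp (ContinuousLinearMap.inr ℝ E (E →L[ℝ] ℝ))) := by
  constructor
  · have aux : ∀ η : CotangentBundle E M, η = ⟨x, p⟩ → HasMFDerivAt (cotangentModel E) L f η D := by
      rintro _ rfl
      exact hf
    refine HasMFDerivAt.comp x (aux _ ?_) (hasMFDerivAt_extend_cotangent x p)
    exact congrArg (TotalSpace.mk x) (FiberBundle.extend_apply_self (E →L[ℝ] ℝ)
      (E := fun y : M ↦ TangentSpace 𝓘(ℝ, E) y →L[ℝ] ℝ) (x := x) p)
  · exact HasMFDerivAt.comp p hf (hasMFDerivAt_fiber_cotangent x p)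

variable [FiniteDimensional ℝ E]

/-- The horizontal lift `T_x M → T_ξ(T*M)` at `ξ ∈ T*_x M` given by `∇`: if `σ` is the 1-form near
`x` with `σ(x) = ξ` and constant coefficients in the canonical coordinates, then
`v^H = dσ(v) - (∇_v σ)^vertical = (v, -∇_v σ)`. As `(∇_i σ)_j = -p_k Γ^k_ij = N_ij`, this is
`(∂/∂x^i)^H = ∂/∂x^i - N_ij ∂/∂p_j`. It is characterized by `horizontalLift_proj` and
`horizontalLift_momentum` below. -/
def horizontalLift (cov : CovariantDerivative 𝓘(ℝ, E) E (TangentSpace 𝓘(ℝ, E) : M → Type _))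
    (ξ : CotangentBundle E M) :
    TangentSpace 𝓘(ℝ, E) ξ.1 →L[ℝ] TangentSpace (cotangentModel E) ξ :=
  haveI : FiniteDimensional ℝ (TangentSpace 𝓘(ℝ, E) ξ.1) := inferInstanceAs (FiniteDimensional ℝ E)
  haveI : T2Space (TangentSpace 𝓘(ℝ, E) ξ.1) := inferInstanceAs (T2Space E)
  LinearMap.toContinuousLinearMap
    { toFun v := ((v, -covDerivOneForm cov
          (FiberBundle.mdifferentiableAt_extend 𝓘(ℝ, E) (E →L[ℝ] ℝ)
            (V := fun y : M ↦ TangentSpace 𝓘(ℝ, E) y →L[ℝ] ℝ) ξ.2) v) : E × (E →L[ℝ] ℝ))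
      map_add' u v := by
        rw [covDerivOneForm_add, neg_add]
        exact Prod.ext rfl rfl
      map_smul' c v := by
        rw [covDerivOneForm_smul]
        exact Prod.ext rfl (smul_neg _ _).symm }

/-- The horizontal lift of `v` projects to `v`. -/
theorem horizontalLift_proj
    (cov : CovariantDerivative 𝓘(ℝ, E) E (TangentSpace 𝓘(ℝ, E) : M → Type _))
    (ξ : CotangentBundle E M) (v : TangentSpace 𝓘(ℝ, E) ξ.1) :
    mfderiv (cotangentModel E) 𝓘(ℝ, E) (TotalSpace.proj : CotangentBundle E M → M) ξ
      (horizontalLift cov ξ v) = v := by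
  have h0 : MDifferentiableAt (cotangentModel E) 𝓘(ℝ, E)
      (TotalSpace.proj : CotangentBundle E M → M) ξ := mdifferentiableAt_proj _
  obtain ⟨h1, h2⟩ := hasMFDerivAt_comp_cotangent (E := E) (G := E) ξ.1 ξ.2 _ h0.hasMFDerivAt
  have e1 := hasMFDerivAt_unique h1 (hasMFDerivAt_id ξ.1)
  have e2 := hasMFDerivAt_unique h2 (hasMFDerivAt_const ξ.1 _)
  have e1' : ∀ u : E, (mfderiv (cotangentModel E) 𝓘(ℝ, E)
    (TotalSpace.proj : CotangentBundle E M → M) ξ : E × (E →L[ℝ] ℝ) →L[ℝ] E) (u, 0) = u :=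
    fun u ↦ DFunLike.congr_fun e1 u
  have e2' : ∀ a : E →L[ℝ] ℝ, (mfderiv (cotangentModel E) 𝓘(ℝ, E)
    (TotalSpace.proj : CotangentBundle E M → M) ξ : E × (E →L[ℝ] ℝ) →L[ℝ] E) (0, a) = 0 :=
    fun a ↦ DFunLike.congr_fun e2 a
  have e3 : ∀ z : E × (E →L[ℝ] ℝ), (mfderiv (cotangentModel E) 𝓘(ℝ, E)
    (TotalSpace.proj : CotangentBundle E M → M) ξ : E × (E →L[ℝ] ℝ) →L[ℝ] E) z = z.1 := by
    intro z
    have h := clm_prod_apply_neg (G₁ := E) (G₂ := E →L[ℝ] ℝ) (G₃ := E) (mfderiv (cotangentModel E) 𝓘(ℝ, E)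
      (TotalSpace.proj : CotangentBundle E M → M) ξ : E × (E →L[ℝ] ℝ) →L[ℝ] E) z.1 (-z.2)
    have h' := h.trans (congrArg₂ (· - ·) (e1' z.1) (e2' (-z.2)))
    rw [neg_neg] at h'
    exact h'.trans (sub_zero z.1)
  exact e3 _

/-- The derivative of the momentum `m(X)(ξ) = ξ(X)` of `X` along the horizontal lift of `v` is
`m(∇_v X)`. -/
theorem horizontalLift_momentum
    (cov : CovariantDerivative 𝓘(ℝ, E) E (TangentSpace 𝓘(ℝ, E) : M → Type _))
    (ξ : CotangentBundle E M) (v : TangentSpace 𝓘(ℝ, E) ξ.1)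
    {X : ∀ y : M, TangentSpace 𝓘(ℝ, E) y} (hX : IsSmoothVectorField X) :
    mvfderiv (cotangentModel E) (fun η : CotangentBundle E M ↦ η.2 (X η.1)) ξ
      (horizontalLift cov ξ v) = ξ.2 (cov X ξ.1 v) := by
  have hX' : MDiffAt (T% X) ξ.1 := (hX ξ.1).mdifferentiableAt (by simp)
  have hm : MDifferentiableAt (cotangentModel E) 𝓘(ℝ, ℝ)
      (fun η : CotangentBundle E M ↦ η.2 (X η.1)) ξ := by
    have h0 : MDifferentiableAt (cotangentModel E) 𝓘(ℝ, E)
      (TotalSpace.proj : CotangentBundle E M → M) ξ := mdifferentiableAt_proj _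
    have h1 : MDifferentiableAt (cotangentModel E) (𝓘(ℝ, E).prod 𝓘(ℝ, E))
        (fun η : CotangentBundle E M ↦ TotalSpace.mk' E η.1 (X η.1)) ξ :=
      MDifferentiableAt.comp ξ hX' h0
    have h2 : MDifferentiableAt (cotangentModel E) (𝓘(ℝ, E).prod 𝓘(ℝ, E →L[ℝ] ℝ))
        (fun η : CotangentBundle E M ↦ TotalSpace.mk' (E →L[ℝ] ℝ)
          (E := fun y : M ↦ TangentSpace 𝓘(ℝ, E) y →L[ℝ] ℝ) η.1 η.2) ξ := mdifferentiableAt_id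
    have := h2.clm_bundle_apply (F₁ := E) (F₂ := ℝ) (E₂ := Trivial M ℝ) h1
    rw [mdifferentiableAt_totalSpace] at this
    exact this.2
  obtain ⟨h1, h2⟩ := hasMFDerivAt_comp_cotangent (E := E) (G := ℝ) ξ.1 ξ.2 _ hm.hasMFDerivAt
  have h3 := covDerivOneForm_apply cov (FiberBundle.mdifferentiableAt_extend 𝓘(ℝ, E) (E →L[ℝ] ℝ)
    (V := fun y : M ↦ TangentSpace 𝓘(ℝ, E) y →L[ℝ] ℝ) ξ.2) v hX'
  rw [FiberBundle.extend_apply_self] at h3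
  have e2 := hasMFDerivAt_unique h2
    (ContinuousLinearMap.apply ℝ ℝ (show E from X ξ.1)).hasFDerivAt.hasMFDerivAt
  set D : E × (E →L[ℝ] ℝ) →L[ℝ] ℝ := mfderiv (cotangentModel E) 𝓘(ℝ, ℝ)
    (fun η : CotangentBundle E M ↦ η.2 (X η.1)) ξ with hD
  set c : E →L[ℝ] ℝ := covDerivOneForm cov
    (FiberBundle.mdifferentiableAt_extend 𝓘(ℝ, E) (E →L[ℝ] ℝ)
      (V := fun y : M ↦ TangentSpace 𝓘(ℝ, E) y →L[ℝ] ℝ) ξ.2) v with hc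
  have e1 : D (v, 0) = mvfderiv 𝓘(ℝ, E) (fun y : M ↦ FiberBundle.extend (E →L[ℝ] ℝ)
      (E := fun y : M ↦ TangentSpace 𝓘(ℝ, E) y →L[ℝ] ℝ) ξ.2 y (X y)) ξ.1 v :=
    (DFunLike.congr_fun h1.mfderiv v).symm
  have e2' : D (0, c) = c (X ξ.1) := DFunLike.congr_fun e2 c
  have e3 : D (v, -c) = D (v, 0) - D (0, c) := clm_prod_apply_neg D v c
  refine Eq.trans (show _ = D (v, -c) from rfl) ?_
  rw [e3, e1, e2']
  have h4 : c (X ξ.1) = _ := h3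
  rw [h4]
  ring

/-- The horizontal lift `w^H` of `w` to `T*M`: `w^H(Φ, Ψ) = w(Φ ∘ h, Ψ ∘ h)` with `h` the
horizontal lift of vectors, i.e. `w^H = (1/2) w^ij δ/δx^i ∧ δ/δx^j`, `δ/δx^i = (∂/∂x^i)^H`. -/
def horizontalLiftTensor
    (cov : CovariantDerivative 𝓘(ℝ, E) E (TangentSpace 𝓘(ℝ, E) : M → Type _))
    (w : ContravariantTwoTensor 𝓘(ℝ, E) M) :
    ContravariantTwoTensor (cotangentModel E) (CotangentBundle E M) := fun ξ ↦
  (ContinuousLinearMap.precomp ℝ (ContinuousLinearMap.precomp ℝ (horizontalLift cov ξ))).comp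
    ((w ξ.1).comp (ContinuousLinearMap.precomp ℝ (horizontalLift cov ξ)))

theorem horizontalLiftTensor_apply
    (cov : CovariantDerivative 𝓘(ℝ, E) E (TangentSpace 𝓘(ℝ, E) : M → Type _))
    (w : ContravariantTwoTensor 𝓘(ℝ, E) M) (ξ : CotangentBundle E M)
    (Φ Ψ : TangentSpace (cotangentModel E) ξ →L[ℝ] ℝ) :
    horizontalLiftTensor cov w ξ Φ Ψ
      = w ξ.1 (Φ.comp (horizontalLift cov ξ)) (Ψ.comp (horizontalLift cov ξ)) := rfl

end Cotangent

end

/-! Everything is computed in canonical coordinates `(x, p)` of `T*M`. With `h` the horizontal lift,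
the horizontal part of a covector `Φ` of `T*M` is `α = Φ ∘ h`, a covector of `M`; its vertical part
is a vector `a` of `M`. At a given point these two parts are arbitrary and independent. Let `Φ`,
`Ψ`, `Θ` have horizontal parts `α`, `β`, `γ` and vertical parts `a`, `b`, `c`, and let `r`, `s`, `t`
be the images of `α`, `β`, `γ` under `♯`.

The Schouten bracket of two bivector fields involves only their first derivatives, since the second
derivatives of the functions cancel (`schouten_vectorSpaceBracket`). The equation `∇w = 0` replaces
the derivative of `w` by Christoffel terms, and these cancel in cyclic sums because the torsion
vanishes. Only curvature survives: the Jacobiator of `w^H` is `p(R(t, s)a + R(r, t)b + R(s, r)c)`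
(`jacobiator_liftModel`), and `[w^H, W_0]` is `p(R(b, c)r + R(c, a)s + R(a, b)t)`
(`schouten_liftModel`).

If `R(u, v)♯α` always vanishes, the second expression is zero term by term. So is the first, because
the Bianchi identity writes `R(♯μ, ♯ν)a` as a sum of curvatures applied to `♯μ` and `♯ν`.
Conversely, in the second expression take `Φ` with vertical part `0` and `Ψ`, `Θ` with horizontal
part `0`: there remains `p(R(b, c)♯α)`, with `p`, `b`, `c`, `α` arbitrary.

The rest carries these formulas to the manifold. A tangent space of `T*M` is identified with `E ×
E*` through the chart preferred at its own base point, so both bivector fields must be expressed in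
one fixed chart before they can be differentiated (`hasChartExpression_horizontalLiftTensor`,
`hasChartExpression_canonicalPoisson`). Bump functions turn coordinate data at a point into global
smooth functions, fields and forms. -/

open Bundle
open scoped Manifold ContDiff Topology

noncomputable section

set_option maxSynthPendingDepth 3
set_option synthInstance.maxHeartbeats 200000

/-! ### Brackets of bivector fields on a vector space. -/

section BivectorCalculus

variable {V : Type*} [NormedAddCommGroup V] [NormedSpace ℝ V]

/-- The bracket of functions on a vector space defined by a field of bilinear forms on its dual. -/
def vectorSpaceBracket (P : V → (V →L[ℝ] ℝ) →L[ℝ] (V →L[ℝ] ℝ) →L[ℝ] ℝ) (f g : V → ℝ) (z : V) : ℝ :=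
  P z (fderiv ℝ f z) (fderiv ℝ g z)

variable {P P₁ P₂ : V → (V →L[ℝ] ℝ) →L[ℝ] (V →L[ℝ] ℝ) →L[ℝ] ℝ} {f g h : V → ℝ} {z : V}

theorem differentiableAt_fderiv_of_contDiffAt (hf : ContDiffAt ℝ 2 f z) :
    DifferentiableAt ℝ (fderiv ℝ f) z :=
  (hf.fderiv_right (m := 1) (by norm_num)).differentiableAt (by simp)

theorem differentiableAt_vectorSpaceBracket (hP : DifferentiableAt ℝ P z)
    (hf : ContDiffAt ℝ 2 f z) (hg : ContDiffAt ℝ 2 g z) :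
    DifferentiableAt ℝ (vectorSpaceBracket P f g) z :=
  (hP.clm_apply (differentiableAt_fderiv_of_contDiffAt hf)).clm_apply
    (differentiableAt_fderiv_of_contDiffAt hg)

theorem fderiv_vectorSpaceBracket (hP : DifferentiableAt ℝ P z)
    (hf : ContDiffAt ℝ 2 f z) (hg : ContDiffAt ℝ 2 g z) (u : V) :
    fderiv ℝ (vectorSpaceBracket P f g) z u =
      fderiv ℝ P z u (fderiv ℝ f z) (fderiv ℝ g z)
        + P z (fderiv ℝ (fderiv ℝ f) z u) (fderiv ℝ g z)
        + P z (fderiv ℝ f z) (fderiv ℝ (fderiv ℝ g) z u) := by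
  have hf' := (differentiableAt_fderiv_of_contDiffAt hf).hasFDerivAt
  have hg' := (differentiableAt_fderiv_of_contDiffAt hg).hasFDerivAt
  have := ((hP.hasFDerivAt.clm_apply hf').clm_apply hg').fderiv
  unfold vectorSpaceBracket
  rw [this]
  simp
  ring

/-- The second derivatives of `f`, `g`, `h` cancel in the Schouten bracket. -/
theorem schouten_vectorSpaceBracket (hP₁ : DifferentiableAt ℝ P₁ z)
    (hP₂ : DifferentiableAt ℝ P₂ z)
    (skew₁ : ∀ Φ Ψ, P₁ z Φ Ψ = -P₁ z Ψ Φ) (skew₂ : ∀ Φ Ψ, P₂ z Φ Ψ = -P₂ z Ψ Φ)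
    {S₁ S₂ : (V →L[ℝ] ℝ) → V} (hS₁ : ∀ Φ Ψ, P₁ z Φ Ψ = Φ (S₁ Ψ)) (hS₂ : ∀ Φ Ψ, P₂ z Φ Ψ = Φ (S₂ Ψ))
    (hf : ContDiffAt ℝ 2 f z) (hg : ContDiffAt ℝ 2 g z) (hh : ContDiffAt ℝ 2 h z) :
    vectorSpaceBracket P₂ (vectorSpaceBracket P₁ f g) h z
      + vectorSpaceBracket P₂ (vectorSpaceBracket P₁ g h) f z
      + vectorSpaceBracket P₂ (vectorSpaceBracket P₁ h f) g z
      + vectorSpaceBracket P₁ (vectorSpaceBracket P₂ f g) h z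
      + vectorSpaceBracket P₁ (vectorSpaceBracket P₂ g h) f z
      + vectorSpaceBracket P₁ (vectorSpaceBracket P₂ h f) g z =
    (fderiv ℝ P₁ z (S₂ (fderiv ℝ h z)) (fderiv ℝ f z) (fderiv ℝ g z)
      + fderiv ℝ P₁ z (S₂ (fderiv ℝ f z)) (fderiv ℝ g z) (fderiv ℝ h z)
      + fderiv ℝ P₁ z (S₂ (fderiv ℝ g z)) (fderiv ℝ h z) (fderiv ℝ f z))
    + (fderiv ℝ P₂ z (S₁ (fderiv ℝ h z)) (fderiv ℝ f z) (fderiv ℝ g z)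
      + fderiv ℝ P₂ z (S₁ (fderiv ℝ f z)) (fderiv ℝ g z) (fderiv ℝ h z)
      + fderiv ℝ P₂ z (S₁ (fderiv ℝ g z)) (fderiv ℝ h z) (fderiv ℝ f z)) := by
  have symm : ∀ {k : V → ℝ}, ContDiffAt ℝ 2 k z → ∀ u v,
      fderiv ℝ (fderiv ℝ k) z u v = fderiv ℝ (fderiv ℝ k) z v u := fun hk u v ↦
    (hk.isSymmSndFDerivAt (by simp)).eq u v
  have e₁ : ∀ F G : V → ℝ, vectorSpaceBracket P₁ F G z = fderiv ℝ F z (S₁ (fderiv ℝ G z)) :=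
    fun F G ↦ hS₁ _ _
  have e₂ : ∀ F G : V → ℝ, vectorSpaceBracket P₂ F G z = fderiv ℝ F z (S₂ (fderiv ℝ G z)) :=
    fun F G ↦ hS₂ _ _
  simp only [e₁, e₂]
  rw [fderiv_vectorSpaceBracket hP₁ hf hg, fderiv_vectorSpaceBracket hP₁ hg hh,
    fderiv_vectorSpaceBracket hP₁ hh hf, fderiv_vectorSpaceBracket hP₂ hf hg,
    fderiv_vectorSpaceBracket hP₂ hg hh, fderiv_vectorSpaceBracket hP₂ hh hf]
  -- Skewness moves each Hessian into the first slot, where `hS₁` and `hS₂` turn it into a second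
  -- derivative evaluated at two vectors. The Hessian terms then cancel in pairs by symmetry of
  -- second derivatives.
  rw [skew₁ (fderiv ℝ f z), skew₁ (fderiv ℝ g z), skew₁ (fderiv ℝ h z),
    skew₂ (fderiv ℝ f z), skew₂ (fderiv ℝ g z), skew₂ (fderiv ℝ h z)]
  simp only [hS₁, hS₂]
  linarith [symm hf (S₂ (fderiv ℝ h z)) (S₁ (fderiv ℝ g z)),
    symm hf (S₁ (fderiv ℝ h z)) (S₂ (fderiv ℝ g z)),
    symm hg (S₂ (fderiv ℝ h z)) (S₁ (fderiv ℝ f z)),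
    symm hg (S₁ (fderiv ℝ h z)) (S₂ (fderiv ℝ f z)),
    symm hh (S₂ (fderiv ℝ f z)) (S₁ (fderiv ℝ g z)),
    symm hh (S₁ (fderiv ℝ f z)) (S₂ (fderiv ℝ g z))]

end BivectorCalculus

/-! ### The horizontal lift in canonical coordinates, and the two curvature formulas. -/

section LocalModel

variable {E : Type*} [NormedAddCommGroup E] [NormedSpace ℝ E] [FiniteDimensional ℝ E]

variable (E) in
/-- The inverse of the evaluation map from `E` to its bidual. -/
def bidualInv : ((E →L[ℝ] ℝ) →L[ℝ] ℝ) →L[ℝ] E :=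
  LinearMap.toContinuousLinearMap
    ((Module.evalEquiv ℝ E).symm.toLinearMap ∘ₗ
      { toFun a := a.toLinearMap ∘ₗ
          (LinearMap.toContinuousLinearMap : (E →ₗ[ℝ] ℝ) ≃ₗ[ℝ] (E →L[ℝ] ℝ)).toLinearMap
        map_add' _ _ := rfl
        map_smul' _ _ := rfl })

@[simp]
theorem apply_bidualInv (a : (E →L[ℝ] ℝ) →L[ℝ] ℝ) (q : E →L[ℝ] ℝ) : q (bidualInv E a) = a q :=
  Module.apply_evalEquiv_symm_apply ℝ E q.toLinearMap
    (a.toLinearMap ∘ₗ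
      (LinearMap.toContinuousLinearMap : (E →ₗ[ℝ] ℝ) ≃ₗ[ℝ] (E →L[ℝ] ℝ)).toLinearMap)

/-- The vertical part of a covector of `E × E*`, as a vector of `E`. -/
def verticalPart : (E × (E →L[ℝ] ℝ) →L[ℝ] ℝ) →L[ℝ] E :=
  (bidualInv E).comp (ContinuousLinearMap.precomp ℝ (ContinuousLinearMap.inr ℝ E (E →L[ℝ] ℝ)))

@[simp]
theorem apply_verticalPart (Φ : E × (E →L[ℝ] ℝ) →L[ℝ] ℝ) (q : E →L[ℝ] ℝ) :
    q (verticalPart Φ) = Φ (0, q) :=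
  apply_bidualInv _ q

/-- The map `Φ ↦ Φ ∘ h` with `h` the horizontal lift with Christoffel symbol `G` at `z = (x, p)`.
Here `G x b v` is the derivative of the constant field `b` in the direction `v`. -/
def horizontalPart (G : E → E →L[ℝ] E →L[ℝ] E) (z : E × (E →L[ℝ] ℝ)) :
    (E × (E →L[ℝ] ℝ) →L[ℝ] ℝ) →L[ℝ] E →L[ℝ] ℝ :=
  ContinuousLinearMap.precomp ℝ (ContinuousLinearMap.inl ℝ E (E →L[ℝ] ℝ))
    + (ContinuousLinearMap.compL ℝ E E ℝ z.2).comp ((G z.1).comp verticalPart)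

theorem horizontalPart_apply (G : E → E →L[ℝ] E →L[ℝ] E) (z : E × (E →L[ℝ] ℝ))
    (Φ : E × (E →L[ℝ] ℝ) →L[ℝ] ℝ) (v : E) :
    horizontalPart G z Φ v = Φ (v, 0) + z.2 (G z.1 (verticalPart Φ) v) := rfl

/-- The horizontal lift of `W` in canonical coordinates. -/
def liftModel (W : E → (E →L[ℝ] ℝ) →L[ℝ] (E →L[ℝ] ℝ) →L[ℝ] ℝ) (G : E → E →L[ℝ] E →L[ℝ] E)
    (z : E × (E →L[ℝ] ℝ)) :
    (E × (E →L[ℝ] ℝ) →L[ℝ] ℝ) →L[ℝ] (E × (E →L[ℝ] ℝ) →L[ℝ] ℝ) →L[ℝ] ℝ :=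
  ((ContinuousLinearMap.compL ℝ (E × (E →L[ℝ] ℝ) →L[ℝ] ℝ) (E →L[ℝ] ℝ) ℝ).flip
    (horizontalPart G z)).comp ((W z.1).comp (horizontalPart G z))

theorem liftModel_apply (W : E → (E →L[ℝ] ℝ) →L[ℝ] (E →L[ℝ] ℝ) →L[ℝ] ℝ)
    (G : E → E →L[ℝ] E →L[ℝ] E) (z : E × (E →L[ℝ] ℝ)) (Φ Ψ : E × (E →L[ℝ] ℝ) →L[ℝ] ℝ) :
    liftModel W G z Φ Ψ = W z.1 (horizontalPart G z Φ) (horizontalPart G z Ψ) := rfl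

/-- The curvature `R(u, v) a` in coordinates. -/
def christoffelCurvature (G : E → E →L[ℝ] E →L[ℝ] E) (x u v a : E) : E :=
  fderiv ℝ G x u a v - fderiv ℝ G x v a u + G x (G x a v) u - G x (G x a u) v

variable {W : E → (E →L[ℝ] ℝ) →L[ℝ] (E →L[ℝ] ℝ) →L[ℝ] ℝ} {G : E → E →L[ℝ] E →L[ℝ] E}

theorem contDiffAt_horizontalPart {n : WithTop ℕ∞} {z : E × (E →L[ℝ] ℝ)}
    (hG : ContDiffAt ℝ n G z.1) : ContDiffAt ℝ n (horizontalPart G) z := by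
  have hG' : ContDiffAt ℝ n (fun y : E × (E →L[ℝ] ℝ) ↦ G y.1) z := hG.comp z contDiffAt_fst
  unfold horizontalPart
  refine contDiffAt_const.add (ContDiffAt.clm_comp ?_ (hG'.clm_comp contDiffAt_const))
  exact (ContinuousLinearMap.contDiff _).contDiffAt.comp z contDiffAt_snd

theorem contDiffAt_liftModel {n : WithTop ℕ∞} {z : E × (E →L[ℝ] ℝ)}
    (hW : ContDiffAt ℝ n W z.1) (hG : ContDiffAt ℝ n G z.1) :
    ContDiffAt ℝ n (liftModel W G) z := by
  have hW' : ContDiffAt ℝ n (fun y : E × (E →L[ℝ] ℝ) ↦ W y.1) z := hW.comp z contDiffAt_fst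
  have hK := contDiffAt_horizontalPart hG
  unfold liftModel
  refine ContDiffAt.clm_comp ?_ (hW'.clm_comp hK)
  exact (ContinuousLinearMap.contDiff _).contDiffAt.comp z hK

theorem fderiv_horizontalPart {z : E × (E →L[ℝ] ℝ)} (hG : DifferentiableAt ℝ G z.1)
    (Φ : E × (E →L[ℝ] ℝ) →L[ℝ] ℝ) (u : E × (E →L[ℝ] ℝ)) :
    HasFDerivAt (fun y ↦ horizontalPart G y Φ) (fderiv ℝ (fun y ↦ horizontalPart G y Φ) z) z ∧
    fderiv ℝ (fun y ↦ horizontalPart G y Φ) z u =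
      u.2.comp (G z.1 (verticalPart Φ)) + z.2.comp (fderiv ℝ G z.1 u.1 (verticalPart Φ)) := by
  have h1 : HasFDerivAt (fun y : E × (E →L[ℝ] ℝ) ↦ G y.1)
      ((fderiv ℝ G z.1).comp (ContinuousLinearMap.fst ℝ E (E →L[ℝ] ℝ))) z :=
    hG.hasFDerivAt.comp z hasFDerivAt_fst
  have h2 := h1.clm_apply (hasFDerivAt_const (verticalPart Φ) z)
  have h3 := (hasFDerivAt_snd (p := z) (𝕜 := ℝ)).clm_comp h2
  have h4 := (hasFDerivAt_const (Φ.comp (ContinuousLinearMap.inl ℝ E (E →L[ℝ] ℝ))) z).add h3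
  have h5 : HasFDerivAt (fun y ↦ horizontalPart G y Φ) _ z := h4
  refine ⟨h5.differentiableAt.hasFDerivAt, ?_⟩
  rw [h5.fderiv]
  ext v
  simp
  ring

theorem fderiv_liftModel {z : E × (E →L[ℝ] ℝ)} (hW : ContDiffAt ℝ 1 W z.1)
    (hG : ContDiffAt ℝ 1 G z.1) (Φ Ψ : E × (E →L[ℝ] ℝ) →L[ℝ] ℝ) (u : E × (E →L[ℝ] ℝ)) :
    fderiv ℝ (liftModel W G) z u Φ Ψ =
      fderiv ℝ W z.1 u.1 (horizontalPart G z Φ) (horizontalPart G z Ψ)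
      + W z.1 (u.2.comp (G z.1 (verticalPart Φ)) + z.2.comp (fderiv ℝ G z.1 u.1 (verticalPart Φ)))
          (horizontalPart G z Ψ)
      + W z.1 (horizontalPart G z Φ)
          (u.2.comp (G z.1 (verticalPart Ψ)) + z.2.comp (fderiv ℝ G z.1 u.1 (verticalPart Ψ))) := by
  have hL : DifferentiableAt ℝ (liftModel W G) z :=
    (contDiffAt_liftModel hW hG).differentiableAt (by simp)
  have e1 := ((hL.hasFDerivAt.clm_apply (hasFDerivAt_const Φ z)).clm_apply
    (hasFDerivAt_const Ψ z)).fderiv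
  have hW1 : HasFDerivAt (fun y : E × (E →L[ℝ] ℝ) ↦ W y.1)
      ((fderiv ℝ W z.1).comp (ContinuousLinearMap.fst ℝ E (E →L[ℝ] ℝ))) z :=
    (hW.differentiableAt (by simp)).hasFDerivAt.comp z hasFDerivAt_fst
  obtain ⟨hΦ, hΦ'⟩ := fderiv_horizontalPart (hG.differentiableAt (by simp)) Φ u
  obtain ⟨hΨ, hΨ'⟩ := fderiv_horizontalPart (hG.differentiableAt (by simp)) Ψ u
  -- The scalar function obtained by fixing `Φ` and `Ψ` is differentiated in two ways: through the
  -- operator-valued map (`e1`) and through the explicit formula (`e2`).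
  have e2 : fderiv ℝ (fun y ↦ liftModel W G y Φ Ψ) z = _ :=
    ((hW1.clm_apply hΦ).clm_apply hΨ).fderiv
  have e3 := DFunLike.congr_fun (e1.symm.trans e2) u
  simp only [add_apply, ContinuousLinearMap.comp_apply, ContinuousLinearMap.flip_apply,
    hΦ', hΨ', zero_apply, map_zero, zero_add,
    ContinuousLinearMap.coe_fst'] at e3
  simp only [map_add, add_apply] at e3 ⊢
  linarith

/-- The values at `x` of a skew field `W` and of the Christoffel symbol `G` of a torsion-free
connection for which `W` is parallel. -/
structure IsPoissonChristoffel (W : E → (E →L[ℝ] ℝ) →L[ℝ] (E →L[ℝ] ℝ) →L[ℝ] ℝ)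
    (G : E → E →L[ℝ] E →L[ℝ] E) (x : E) : Prop where
  contDiffAt_bivector : ContDiffAt ℝ ∞ W x
  contDiffAt_christoffel : ContDiffAt ℝ ∞ G x
  skew : ∀ α β, W x α β = -W x β α
  symm : ∀ᶠ y in 𝓝 x, ∀ u v, G y u v = G y v u
  parallel : ∀ (t : E) (α β : E →L[ℝ] ℝ), fderiv ℝ W x t α β =
    -W x (α.comp ((G x).flip t)) β - W x α (β.comp ((G x).flip t))

namespace IsPoissonChristoffel

variable {x : E}

theorem symm_self (h : IsPoissonChristoffel W G x) (u v : E) : G x u v = G x v u :=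
  h.symm.self_of_nhds u v

/-- The symmetry of the Christoffel symbol can be differentiated because it holds on a neighbourhood
of `x`, not only at `x`. -/
theorem fderiv_symm (h : IsPoissonChristoffel W G x) (t u v : E) :
    fderiv ℝ G x t u v = fderiv ℝ G x t v u := by
  have hG := (h.contDiffAt_christoffel.differentiableAt (by simp)).hasFDerivAt
  have key : ∀ u v : E, fderiv ℝ (fun y ↦ G y u v) x t = fderiv ℝ G x t u v := by
    intro u v
    rw [((hG.clm_apply (hasFDerivAt_const u x)).clm_apply (hasFDerivAt_const v x)).fderiv]
    simp
  rw [← key u v, ← key v u]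
  have : (fun y ↦ G y u v) =ᶠ[𝓝 x] fun y ↦ G y v u := h.symm.mono fun y hy ↦ hy u v
  rw [this.fderiv_eq]

/-- The vector `♯ α`. -/
def _root_.modelSharp (B : (E →L[ℝ] ℝ) →L[ℝ] (E →L[ℝ] ℝ) →L[ℝ] ℝ) (α : E →L[ℝ] ℝ) : E :=
  bidualInv E (B α)

theorem _root_.apply_modelSharp (B : (E →L[ℝ] ℝ) →L[ℝ] (E →L[ℝ] ℝ) →L[ℝ] ℝ) (α β : E →L[ℝ] ℝ) :
    B α β = β (modelSharp B α) :=
  (apply_bidualInv _ _).symm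

theorem liftModel_skew (h : IsPoissonChristoffel W G x) (p : E →L[ℝ] ℝ)
    (Φ Ψ : E × (E →L[ℝ] ℝ) →L[ℝ] ℝ) : liftModel W G (x, p) Φ Ψ = -liftModel W G (x, p) Ψ Φ :=
  h.skew _ _

/-- Parallelism eliminates the derivative of `W`, so that only `G` and its derivative remain. The
equations in the hypotheses give short names to the horizontal and vertical parts, which `ring` then
treats as atoms in the cyclic sums. -/
theorem fderiv_liftModel (h : IsPoissonChristoffel W G x) (p : E →L[ℝ] ℝ)
    (Φ Ψ : E × (E →L[ℝ] ℝ) →L[ℝ] ℝ) (t : E) (q : E →L[ℝ] ℝ) {α β : E →L[ℝ] ℝ} {a b r s : E}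
    (hα : horizontalPart G (x, p) Φ = α) (hβ : horizontalPart G (x, p) Ψ = β)
    (ha : verticalPart Φ = a) (hb : verticalPart Ψ = b)
    (hr : modelSharp (W x) α = r) (hs : modelSharp (W x) β = s) :
    fderiv ℝ (liftModel W G) (x, p) (t, q) Φ Ψ =
      α (G x s t) - β (G x r t) - q (G x a s) - p (fderiv ℝ G x t a s)
        + q (G x b r) + p (fderiv ℝ G x t b r) := by
  rw [_root_.fderiv_liftModel (h.contDiffAt_bivector.of_le (by norm_cast))
    (h.contDiffAt_christoffel.of_le (by norm_cast))]
  simp only [hα, hβ, ha, hb]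
  rw [h.parallel, h.skew _ β, h.skew (q.comp _ + _) β]
  simp only [apply_modelSharp, hr, hs]
  simp
  ring

/-- `liftModel W G (x, p) Φ Ψ = Φ (S Ψ)`. -/
theorem liftModel_eq (h : IsPoissonChristoffel W G x) (p : E →L[ℝ] ℝ)
    (Φ Ψ : E × (E →L[ℝ] ℝ) →L[ℝ] ℝ) :
    liftModel W G (x, p) Φ Ψ =
      Φ (-modelSharp (W x) (horizontalPart G (x, p) Ψ),
        -p.comp ((G x).flip (modelSharp (W x) (horizontalPart G (x, p) Ψ)))) := by
  rw [h.liftModel_skew, liftModel_apply, apply_modelSharp, horizontalPart_apply]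
  set t := modelSharp (W x) (horizontalPart G (x, p) Ψ) with ht
  have : p (G x (verticalPart Φ) t) = Φ (0, p.comp ((G x).flip t)) := by
    rw [← apply_verticalPart]; simp
  change -(Φ (t, 0) + p (G x (verticalPart Φ) t)) = _
  rw [this, ← map_add, ← map_neg]
  simp

/-- The Jacobiator of the horizontal lift. -/
theorem jacobiator_liftModel (h : IsPoissonChristoffel W G x) (p : E →L[ℝ] ℝ)
    (Φ Ψ Θ : E × (E →L[ℝ] ℝ) →L[ℝ] ℝ) {r s t a b c : E}
    (ha : verticalPart Φ = a) (hb : verticalPart Ψ = b) (hc : verticalPart Θ = c)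
    (hr : modelSharp (W x) (horizontalPart G (x, p) Φ) = r)
    (hs : modelSharp (W x) (horizontalPart G (x, p) Ψ) = s)
    (ht : modelSharp (W x) (horizontalPart G (x, p) Θ) = t) :
    fderiv ℝ (liftModel W G) (x, p) (-t, -p.comp ((G x).flip t)) Φ Ψ
      + fderiv ℝ (liftModel W G) (x, p) (-r, -p.comp ((G x).flip r)) Ψ Θ
      + fderiv ℝ (liftModel W G) (x, p) (-s, -p.comp ((G x).flip s)) Θ Φ =
    p (christoffelCurvature G x t s a) + p (christoffelCurvature G x r t b)
      + p (christoffelCurvature G x s r c) := by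
  rw [h.fderiv_liftModel p Φ Ψ _ _ rfl rfl ha hb hr hs,
    h.fderiv_liftModel p Ψ Θ _ _ rfl rfl hb hc hs ht,
    h.fderiv_liftModel p Θ Φ _ _ rfl rfl hc ha ht hr]
  simp only [christoffelCurvature, map_neg, map_add, map_sub, neg_apply,
    ContinuousLinearMap.comp_apply, ContinuousLinearMap.flip_apply]
  -- Once `G` is symmetric, the terms coming from `∇w = 0` cancel in the cyclic sum; the others
  -- group into curvatures.
  rw [h.symm_self s t, h.symm_self r t, h.symm_self r s]
  ring

variable (E) in
/-- The canonical Poisson structure in canonical coordinates. -/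
def _root_.canonicalModel :
    (E × (E →L[ℝ] ℝ) →L[ℝ] ℝ) →L[ℝ] (E × (E →L[ℝ] ℝ) →L[ℝ] ℝ) →L[ℝ] ℝ :=
  let A : (E × (E →L[ℝ] ℝ) →L[ℝ] ℝ) →L[ℝ] (E × (E →L[ℝ] ℝ) →L[ℝ] ℝ) →L[ℝ] ℝ :=
    (ContinuousLinearMap.precomp ℝ
      (ContinuousLinearMap.precomp ℝ (ContinuousLinearMap.inl ℝ E (E →L[ℝ] ℝ)))).comp
      (ContinuousLinearMap.precomp ℝ (ContinuousLinearMap.inr ℝ E (E →L[ℝ] ℝ)))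
  A - A.flip

theorem _root_.canonicalModel_apply (Φ Ψ : E × (E →L[ℝ] ℝ) →L[ℝ] ℝ) :
    canonicalModel E Φ Ψ =
      Φ (0, Ψ.comp (ContinuousLinearMap.inl ℝ E (E →L[ℝ] ℝ))) -
        Ψ (0, Φ.comp (ContinuousLinearMap.inl ℝ E (E →L[ℝ] ℝ))) := rfl

theorem _root_.canonicalModel_eq (Φ Ψ : E × (E →L[ℝ] ℝ) →L[ℝ] ℝ) :
    canonicalModel E Φ Ψ =
      Φ (-verticalPart Ψ, Ψ.comp (ContinuousLinearMap.inl ℝ E (E →L[ℝ] ℝ))) := by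
  rw [canonicalModel_apply, ← apply_verticalPart Ψ]
  have : Φ.comp (ContinuousLinearMap.inl ℝ E (E →L[ℝ] ℝ)) (verticalPart Ψ)
    = Φ (verticalPart Ψ, 0) := rfl
  rw [this, ← map_sub]
  simp

/-- The Schouten bracket of the horizontal lift and the canonical Poisson structure. -/
theorem schouten_liftModel (h : IsPoissonChristoffel W G x) (p : E →L[ℝ] ℝ)
    (Φ Ψ Θ : E × (E →L[ℝ] ℝ) →L[ℝ] ℝ) {r s t a b c : E}
    (ha : verticalPart Φ = a) (hb : verticalPart Ψ = b) (hc : verticalPart Θ = c)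
    (hr : modelSharp (W x) (horizontalPart G (x, p) Φ) = r)
    (hs : modelSharp (W x) (horizontalPart G (x, p) Ψ) = s)
    (ht : modelSharp (W x) (horizontalPart G (x, p) Θ) = t) :
    fderiv ℝ (liftModel W G) (x, p)
        (-c, Θ.comp (ContinuousLinearMap.inl ℝ E (E →L[ℝ] ℝ))) Φ Ψ
      + fderiv ℝ (liftModel W G) (x, p)
        (-a, Φ.comp (ContinuousLinearMap.inl ℝ E (E →L[ℝ] ℝ))) Ψ Θ
      + fderiv ℝ (liftModel W G) (x, p)
        (-b, Ψ.comp (ContinuousLinearMap.inl ℝ E (E →L[ℝ] ℝ))) Θ Φ =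
    p (christoffelCurvature G x b c r) + p (christoffelCurvature G x c a s)
      + p (christoffelCurvature G x a b t) := by
  -- The vertical component of the direction is a horizontal part minus its Christoffel correction.
  -- The horizontal parts cancel the terms coming from `∇w = 0`; the corrections give the quadratic
  -- terms of the curvature.
  have e : ∀ (Φ : E × (E →L[ℝ] ℝ) →L[ℝ] ℝ) (v : E),
      Φ.comp (ContinuousLinearMap.inl ℝ E (E →L[ℝ] ℝ)) v =
        horizontalPart G (x, p) Φ v - p (G x (verticalPart Φ) v) := by
    intro Φ v
    rw [horizontalPart_apply]
    simp
  rw [h.fderiv_liftModel p Φ Ψ _ _ rfl rfl ha hb hr hs,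
    h.fderiv_liftModel p Ψ Θ _ _ rfl rfl hb hc hs ht,
    h.fderiv_liftModel p Θ Φ _ _ rfl rfl hc ha ht hr]
  simp only [e, ha, hb, hc, christoffelCurvature, map_neg, map_add, map_sub, neg_apply]
  rw [h.fderiv_symm c a s, h.fderiv_symm c b r, h.fderiv_symm a b t, h.fderiv_symm a c s,
    h.fderiv_symm b c r, h.fderiv_symm b a t]
  rw [h.symm_self a s, h.symm_self b r, h.symm_self b t, h.symm_self c s, h.symm_self c r,
    h.symm_self a t, h.symm_self c (G x s a), h.symm_self c (G x r b), h.symm_self a (G x t b),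
    h.symm_self a (G x s c), h.symm_self b (G x r c), h.symm_self b (G x t a)]
  ring

/-- The first Bianchi identity. -/
theorem bianchi (h : IsPoissonChristoffel W G x) (u v a : E) :
    christoffelCurvature G x u v a + christoffelCurvature G x v a u
      + christoffelCurvature G x a u v = 0 := by
  simp only [christoffelCurvature]
  rw [h.fderiv_symm u a v, h.fderiv_symm v a u, h.fderiv_symm a u v, h.symm_self a v,
    h.symm_self a u, h.symm_self u v]
  abel

end IsPoissonChristoffel

end LocalModel

/-! ### Forms, functions and tensors in a fixed chart of a manifold. -/

section ChartCoordinates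

/-- In finite dimension an operator is determined linearly by its values on a basis, so smoothness
can be tested on vectors. This brings smoothness of bivectors and Christoffel symbols down to
smoothness of their components. -/
theorem ContDiffAt.of_clm_apply {D F G : Type*} [NormedAddCommGroup D] [NormedSpace ℝ D]
    [NormedAddCommGroup F] [NormedSpace ℝ F] [FiniteDimensional ℝ F]
    [NormedAddCommGroup G] [NormedSpace ℝ G] {n : WithTop ℕ∞} {f : D → F →L[ℝ] G} {x : D}
    (h : ∀ y, ContDiffAt ℝ n (fun z ↦ f z y) x) : ContDiffAt ℝ n f x := by
  let d := Module.finrank ℝ F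
  have hd : d = Module.finrank ℝ (Fin d → ℝ) := (Module.finrank_fin_fun ℝ).symm
  let e₁ := ContinuousLinearEquiv.ofFinrankEq hd
  let e₂ := (e₁.arrowCongr (1 : G ≃L[ℝ] G)).trans (ContinuousLinearEquiv.piRing (Fin d))
  rw [← Function.id_comp f, ← e₂.symm_comp_self]
  exact e₂.symm.contDiff.contDiffAt.comp x (contDiffAt_pi.mpr fun i ↦ h _)

variable {F : Type*} [NormedAddCommGroup F] [NormedSpace ℝ F]
  {H : Type*} [TopologicalSpace H] (J : ModelWithCorners ℝ F H)
  {N : Type*} [TopologicalSpace N] [ChartedSpace H N] [IsManifold J ∞ N]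

/-- The derivative at `y` of the preferred chart at `x`. -/
abbrev chartDeriv (x y : N) : TangentSpace J y →L[ℝ] F :=
  (trivializationAt F (TangentSpace J) x).continuousLinearMapAt ℝ y

/-- The inverse of `chartDeriv J x y`. -/
abbrev chartDerivSymm (x y : N) : F →L[ℝ] TangentSpace J y :=
  (trivializationAt F (TangentSpace J) x).symmL ℝ y

/-- The 1-form near `x` with constant coefficients `α` in the preferred chart at `x`. -/
def chartForm (x : N) (α : F →L[ℝ] ℝ) (y : N) : TangentSpace J y →L[ℝ] ℝ :=
  α.comp (chartDeriv J x y)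

variable {J}
variable {x y : N}

theorem chartDerivSymm_chartDeriv (hy : y ∈ (chartAt H x).source) (v : TangentSpace J y) :
    chartDerivSymm J x y (chartDeriv J x y v) = v :=
  (trivializationAt F (TangentSpace J) x).symmL_continuousLinearMapAt (by simpa using hy) v

theorem chartDeriv_chartDerivSymm (hy : y ∈ (chartAt H x).source) (b : F) :
    chartDeriv J x y (chartDerivSymm J x y b) = b :=
  (trivializationAt F (TangentSpace J) x).continuousLinearMapAt_symmL (by simpa using hy) b

theorem smoothOneFormAt_chartForm (α : F →L[ℝ] ℝ) (hy : y ∈ (chartAt H x).source) :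
    SmoothOneFormAt (J := J) (chartForm J x α) y := by
  unfold SmoothOneFormAt
  rw [Bundle.Trivialization.contMDiffAt_section_iff
    (trivializationAt (F →L[ℝ] ℝ) (fun y : N ↦ TangentSpace J y →L[ℝ] ℝ) x) (by simpa using hy)]
  refine (contMDiffAt_const (c := α)).congr_of_eventuallyEq ?_
  filter_upwards [(chartAt H x).open_source.mem_nhds hy] with z hz
  ext v
  have := chartDeriv_chartDerivSymm (J := J) hz v
  simp only [hom_trivializationAt_apply, ContinuousLinearMap.inCoordinates, chartForm,
    ContinuousLinearMap.comp_apply, this]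
  simp

theorem SmoothOneFormAt.contMDiffAt_coord {β : ∀ y : N, TangentSpace J y →L[ℝ] ℝ}
    (hβ : SmoothOneFormAt β x) :
    ContMDiffAt J 𝓘(ℝ, F →L[ℝ] ℝ) ∞
      (fun y ↦ ((β y).comp (chartDerivSymm J x y) : F →L[ℝ] ℝ)) x := by
  have := ((contMDiffAt_hom_bundle _).1 hβ).2
  refine this.congr_of_eventuallyEq (Filter.Eventually.of_forall fun y ↦ ?_)
  ext v
  simp [ContinuousLinearMap.inCoordinates]

theorem chartForm_coord (hy : y ∈ (chartAt H x).source) (β : TangentSpace J y →L[ℝ] ℝ) :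
    chartForm J x (β.comp (chartDerivSymm J x y)) y = β := by
  ext v
  exact congrArg β (chartDerivSymm_chartDeriv hy v)

variable {G : Type*} [NormedAddCommGroup G] [NormedSpace ℝ G]

theorem HasFDerivAt.hasMFDerivAt_comp_extChartAt (hy : y ∈ (chartAt H x).source) {g : F → G}
    {g' : F →L[ℝ] G} (hg : HasFDerivAt g g' (extChartAt J x y)) :
    HasMFDerivAt J 𝓘(ℝ, G) (fun z ↦ g (extChartAt J x z)) y (g'.comp (chartDeriv J x y)) := by
  have h1 : HasMFDerivAt J 𝓘(ℝ, F) (extChartAt J x) y (chartDeriv J x y) := by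
    have h0 := (mdifferentiableAt_extChartAt (I := J) hy).hasMFDerivAt
    rwa [← TangentBundle.continuousLinearMapAt_trivializationAt hy] at h0
  exact hg.hasMFDerivAt.comp y h1

theorem HasFDerivAt.mvfderiv_apply_of_eventuallyEq (hy : y ∈ (chartAt H x).source) {g : F → G}
    {g' : F →L[ℝ] G} (hg : HasFDerivAt g g' (extChartAt J x y)) {f : N → G}
    (h : ∀ᶠ z in 𝓝 y, f z = g (extChartAt J x z)) (v : TangentSpace J y) :
    mvfderiv J f y v = g' (chartDeriv J x y v) :=
  DFunLike.congr_fun ((hg.hasMFDerivAt_comp_extChartAt hy).congr_of_eventuallyEq h).mfderiv v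

theorem eventuallyEq_comp_extChartAt (hy : y ∈ (chartAt H x).source) (f : N → G) :
    f =ᶠ[𝓝 y] fun z ↦ (f ∘ (extChartAt J x).symm) (extChartAt J x z) := by
  filter_upwards [(chartAt H x).open_source.mem_nhds hy] with z hz
  simp [hz]

variable [J.Boundaryless]

theorem ContMDiffAt.contDiffAt_comp_extChartAt_symm {n : WithTop ℕ∞} (hn : n ≤ ∞)
    (hy : y ∈ (chartAt H x).source) {f : N → G} (hf : ContMDiffAt J 𝓘(ℝ, G) n f y) :
    ContDiffAt ℝ n (f ∘ (extChartAt J x).symm) (extChartAt J x y) := by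
  have hz : extChartAt J x y ∈ (extChartAt J x).target :=
    (extChartAt J x).map_source (by simpa using hy)
  have h1 : ContMDiffAt 𝓘(ℝ, F) J n (extChartAt J x).symm (extChartAt J x y) :=
    ((contMDiffOn_extChartAt_symm (n := ∞) x).contMDiffAt
      ((isOpen_extChartAt_target x).mem_nhds hz)).of_le hn
  have h2 : (extChartAt J x).symm (extChartAt J x y) = y := by simp [hy]
  exact (hf.comp_of_eq h1 h2).contDiffAt

theorem MDifferentiableAt.differentiableAt_comp_extChartAt_symm
    (hy : y ∈ (chartAt H x).source) {f : N → G} (hf : MDifferentiableAt J 𝓘(ℝ, G) f y) :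
    DifferentiableAt ℝ (f ∘ (extChartAt J x).symm) (extChartAt J x y) := by
  have hz : extChartAt J x y ∈ (extChartAt J x).target :=
    (extChartAt J x).map_source (by simpa using hy)
  have h1 : MDifferentiableAt 𝓘(ℝ, F) J (extChartAt J x).symm (extChartAt J x y) :=
    ((contMDiffOn_extChartAt_symm (n := ∞) x).contMDiffAt
      ((isOpen_extChartAt_target x).mem_nhds hz)).mdifferentiableAt (by simp)
  have h2 : (extChartAt J x).symm (extChartAt J x y) = y := by simp [hy]
  exact (MDifferentiableAt.comp_of_eq (hg := hf) (hf := h1) (hy := h2)).differentiableAt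

theorem mvfderiv_eq_fderiv (hy : y ∈ (chartAt H x).source) {f : N → G}
    (hf : MDifferentiableAt J 𝓘(ℝ, G) f y) :
    mvfderiv J f y =
      (fderiv ℝ (f ∘ (extChartAt J x).symm) (extChartAt J x y)).comp (chartDeriv J x y) :=
  (((hf.differentiableAt_comp_extChartAt_symm hy).hasFDerivAt.hasMFDerivAt_comp_extChartAt
    hy).congr_of_eventuallyEq (eventuallyEq_comp_extChartAt hy f)).mfderiv

theorem ContDiffAt.contMDiffAt_comp_extChartAt {n : WithTop ℕ∞} (hn : n ≤ ∞)
    (hy : y ∈ (chartAt H x).source) {g : F → G} (hg : ContDiffAt ℝ n g (extChartAt J x y)) :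
    ContMDiffAt J 𝓘(ℝ, G) n (fun z ↦ g (extChartAt J x z)) y :=
  hg.contMDiffAt.comp y ((contMDiffAt_extChartAt' (n := ∞) hy).of_le hn)

/-- The local expression of a contravariant tensor in the preferred chart at `x` is `Q`. -/
def HasChartExpression (P : ContravariantTwoTensor J N) (x : N)
    (Q : F → (F →L[ℝ] ℝ) →L[ℝ] (F →L[ℝ] ℝ) →L[ℝ] ℝ) : Prop :=
  ∀ y ∈ (chartAt H x).source, ∀ Φ Ψ : F →L[ℝ] ℝ,
    P y (chartForm J x Φ y) (chartForm J x Ψ y) = Q (extChartAt J x y) Φ Ψ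

end ChartCoordinates

/-! ### Christoffel symbols and curvature in a chart. -/

section ConnectionInChart

variable {E : Type*} [NormedAddCommGroup E] [NormedSpace ℝ E]
  {M : Type*} [TopologicalSpace M] [ChartedSpace E M] [IsManifold 𝓘(ℝ, E) ∞ M]

/-- The vector field near `x` with constant coefficients `b` in the preferred chart at `x`. -/
def coordField (x : M) (b : E) (y : M) : TangentSpace 𝓘(ℝ, E) y :=
  chartDerivSymm 𝓘(ℝ, E) x y b

variable {x y : M}

theorem coordField_add (x : M) (a b : E) :
    coordField x (a + b) = coordField x a + coordField x b := by
  ext y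
  exact map_add _ _ _

theorem coordField_smul (x : M) (c : ℝ) (b : E) : coordField x (c • b) = c • coordField x b := by
  ext y
  exact map_smul _ _ _

theorem contMDiffAt_section_of_coord {Z : ∀ y : M, TangentSpace 𝓘(ℝ, E) y} {n : WithTop ℕ∞}
    (hn : n ≤ ∞) (hy : y ∈ (chartAt E x).source) :
    ContMDiffAt 𝓘(ℝ, E) (𝓘(ℝ, E).prod 𝓘(ℝ, E)) n (fun z ↦ TotalSpace.mk' E z (Z z)) y ↔
      ContMDiffAt 𝓘(ℝ, E) 𝓘(ℝ, E) n (fun z ↦ chartDeriv 𝓘(ℝ, E) x z (Z z)) y := by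
  have : ContMDiffVectorBundle n E (TangentSpace 𝓘(ℝ, E) : M → Type _) 𝓘(ℝ, E) :=
    ContMDiffVectorBundle.of_le hn
  rw [Bundle.Trivialization.contMDiffAt_section_iff
    (trivializationAt E (TangentSpace 𝓘(ℝ, E)) x) (by simpa using hy)]
  refine Filter.EventuallyEq.contMDiffAt_iff ?_
  filter_upwards [(chartAt E x).open_source.mem_nhds hy] with z hz
  rw [Trivialization.continuousLinearMapAt_apply, Trivialization.coe_linearMapAt_of_mem]
  simpa using hz

theorem mdifferentiableAt_section_iff_coord {Z : ∀ y : M, TangentSpace 𝓘(ℝ, E) y}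
    (hy : y ∈ (chartAt E x).source) :
    MDifferentiableAt 𝓘(ℝ, E) (𝓘(ℝ, E).prod 𝓘(ℝ, E)) (fun z ↦ TotalSpace.mk' E z (Z z)) y ↔
      MDifferentiableAt 𝓘(ℝ, E) 𝓘(ℝ, E) (fun z ↦ chartDeriv 𝓘(ℝ, E) x z (Z z)) y := by
  rw [(trivializationAt E (TangentSpace 𝓘(ℝ, E)) x).mdifferentiableAt_section_iff 𝓘(ℝ, E) _
    (by simpa using hy)]
  refine Filter.EventuallyEq.mdifferentiableAt_iff ?_
  filter_upwards [(chartAt E x).open_source.mem_nhds hy] with z hz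
  rw [Trivialization.continuousLinearMapAt_apply, Trivialization.coe_linearMapAt_of_mem]
  simpa using hz

theorem contMDiffAt_coordField (b : E) (hy : y ∈ (chartAt E x).source) :
    ContMDiffAt 𝓘(ℝ, E) (𝓘(ℝ, E).prod 𝓘(ℝ, E)) ∞
      (fun z ↦ TotalSpace.mk' E z (coordField x b z)) y := by
  rw [contMDiffAt_section_of_coord le_rfl hy]
  refine (contMDiffAt_const (c := b)).congr_of_eventuallyEq ?_
  filter_upwards [(chartAt E x).open_source.mem_nhds hy] with z hz
  exact chartDeriv_chartDerivSymm hz b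

theorem mdifferentiableAt_coordField (b : E) (hy : y ∈ (chartAt E x).source) :
    MDifferentiableAt 𝓘(ℝ, E) (𝓘(ℝ, E).prod 𝓘(ℝ, E))
      (fun z ↦ TotalSpace.mk' E z (coordField x b z)) y :=
  (contMDiffAt_coordField b hy).mdifferentiableAt (by simp)

theorem chartDeriv_coordField (b : E) (hy : y ∈ (chartAt E x).source) :
    chartDeriv 𝓘(ℝ, E) x y (coordField x b y) = b :=
  chartDeriv_chartDerivSymm hy b

theorem coordField_chartDeriv (hy : y ∈ (chartAt E x).source) (v : TangentSpace 𝓘(ℝ, E) y) :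
    coordField x (chartDeriv 𝓘(ℝ, E) x y v) y = v :=
  chartDerivSymm_chartDeriv hy v

/-- The constant vector field on `E`. -/
def constVectorField {E : Type*} [NormedAddCommGroup E] [NormedSpace ℝ E] (b z : E) :
    TangentSpace 𝓘(ℝ, E) z := b

theorem mpullback_const_extChartAt (b : E) (hy : y ∈ (chartAt E x).source) :
    VectorField.mpullback 𝓘(ℝ, E) 𝓘(ℝ, E) (extChartAt 𝓘(ℝ, E) x)
      (constVectorField b) y = coordField x b y := by
  rw [VectorField.mpullback_apply]
  have h1 := TangentBundle.continuousLinearMapAt_trivializationAt (I := 𝓘(ℝ, E)) hy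
  have : (mfderiv 𝓘(ℝ, E) 𝓘(ℝ, E) (extChartAt 𝓘(ℝ, E) x) y).inverse =
      chartDerivSymm 𝓘(ℝ, E) x y := by
    refine ContinuousLinearMap.inverse_eq ?_ ?_
    · ext v
      have := chartDeriv_chartDerivSymm (J := 𝓘(ℝ, E)) hy v
      exact (DFunLike.congr_fun h1 _).symm.trans this
    · ext v
      have := chartDerivSymm_chartDeriv (J := 𝓘(ℝ, E)) hy v
      exact (congrArg (chartDerivSymm 𝓘(ℝ, E) x y) (DFunLike.congr_fun h1 v)).symm.trans this
  rw [this]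
  rfl

/-- Near `y` these fields are pullbacks under the chart of constant fields. The Lie bracket is
natural under pullback, and constant fields commute. -/
theorem mlieBracket_coordField [CompleteSpace E] (a b : E) (hy : y ∈ (chartAt E x).source) :
    VectorField.mlieBracket 𝓘(ℝ, E) (coordField x a) (coordField x b) y = 0 := by
  have key : ∀ b : E, coordField x b =ᶠ[𝓝 y] VectorField.mpullback 𝓘(ℝ, E) 𝓘(ℝ, E)
      (extChartAt 𝓘(ℝ, E) x) (constVectorField b) := by
    intro b
    filter_upwards [(chartAt E x).open_source.mem_nhds hy] with z hz
    exact (mpullback_const_extChartAt b hz).symm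
  have hc : ∀ b : E, MDifferentiableAt 𝓘(ℝ, E) (𝓘(ℝ, E).prod 𝓘(ℝ, E))
      (fun z : E ↦ TotalSpace.mk' E z (constVectorField b z)) (extChartAt 𝓘(ℝ, E) x y) := by
    intro b
    refine ContMDiffAt.mdifferentiableAt (n := ∞) ?_ (by simp)
    rw [contMDiffAt_vectorSpace_iff_contDiffAt]
    exact contDiffAt_const
  have : IsManifold 𝓘(ℝ, E) (minSmoothness ℝ 2) M := by
    rw [minSmoothness_of_isRCLikeNormedField]; infer_instance
  rw [Filter.EventuallyEq.mlieBracket_vectorField_eq (key a) (key b),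
    ← VectorField.mpullback_mlieBracket (n := ∞) (hc a) (hc b)
      (contMDiffAt_extChartAt' (I := 𝓘(ℝ, E)) hy) (by simp; norm_cast)]
  rw [VectorField.mpullback_apply, ← VectorField.mlieBracketWithin_univ,
    VectorField.mlieBracketWithin_eq_lieBracketWithin]
  have : VectorField.lieBracketWithin ℝ (constVectorField a) (constVectorField b) Set.univ
      (extChartAt 𝓘(ℝ, E) x y) = 0 := by
    unfold constVectorField
    simp [VectorField.lieBracketWithin]
  exact (congrArg _ this).trans (map_zero _)

/-- Vector fields defined near `x` coincide near `x` with globally smooth ones. -/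
theorem exists_isSmoothVectorField_eventuallyEq [FiniteDimensional ℝ E] [T2Space M] (x₀ : M)
    (b : E) (hy : y ∈ (chartAt E x₀).source) : ∃ X : ∀ y : M, TangentSpace 𝓘(ℝ, E) y,
      IsSmoothVectorField X ∧ ∀ᶠ z in 𝓝 y, X z = coordField x₀ b z := by
  obtain ⟨ρ, -, hρ⟩ := (SmoothBumpFunction.nhds_basis_tsupport (I := 𝓘(ℝ, E)) y).mem_iff.1
    ((chartAt E x₀).open_source.mem_nhds hy)
  -- The bump function has its topological support in the chart domain, so the product extends
  -- smoothly by zero, and it equals `1` near `y`.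
  refine ⟨(ρ : M → ℝ) • coordField x₀ b, ?_, ?_⟩
  · exact ContMDiffOn.smul_section_of_tsupport (u := (chartAt E x₀).source)
      ρ.contMDiff.contMDiffOn (chartAt E x₀).open_source hρ
      fun z hz ↦ (contMDiffAt_coordField b hz).contMDiffWithinAt
  · filter_upwards [ρ.eventuallyEq_one] with z hz
    simp [hz]

theorem exists_smoothOneForm_eventuallyEq [FiniteDimensional ℝ E] [T2Space M] (x : M)
    (α : E →L[ℝ] ℝ) : ∃ β : ∀ y : M, TangentSpace 𝓘(ℝ, E) y →L[ℝ] ℝ,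
      (∀ y, SmoothOneFormAt β y) ∧ ∀ᶠ z in 𝓝 x, β z = chartForm 𝓘(ℝ, E) x α z := by
  obtain ⟨ρ, -, hρ⟩ := (SmoothBumpFunction.nhds_basis_tsupport (I := 𝓘(ℝ, E)) x).mem_iff.1
    ((chartAt E x).open_source.mem_nhds (mem_chart_source E x))
  refine ⟨(ρ : M → ℝ) • chartForm 𝓘(ℝ, E) x α, ?_, ?_⟩
  · exact ContMDiffOn.smul_section_of_tsupport (u := (chartAt E x).source)
      ρ.contMDiff.contMDiffOn (chartAt E x).open_source hρ
      fun z hz ↦ (smoothOneFormAt_chartForm α hz).contMDiffWithinAt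
  · filter_upwards [ρ.eventuallyEq_one] with z hz
    simp [hz]

variable [FiniteDimensional ℝ E]
  (cov : CovariantDerivative 𝓘(ℝ, E) E (TangentSpace 𝓘(ℝ, E) : M → Type _))

open Classical in
/-- The Christoffel symbol of `cov` in the preferred chart at `x`: `christoffel cov x z b v` is the
derivative of the field with constant coefficients `b` in the direction `v`. -/
def christoffel (x : M) (z : E) : E →L[ℝ] E →L[ℝ] E :=
  -- Linearity in `b` uses differentiability of the coordinate fields at the base point, which is
  -- available only in the chart domain; elsewhere the value is `0`.
  if hy : (extChartAt 𝓘(ℝ, E) x).symm z ∈ (chartAt E x).source then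
    LinearMap.toContinuousLinearMap
      { toFun b := (chartDeriv 𝓘(ℝ, E) x _).comp ((cov (coordField x b) _).comp
          (chartDerivSymm 𝓘(ℝ, E) x ((extChartAt 𝓘(ℝ, E) x).symm z)))
        map_add' a b := by
          rw [coordField_add, cov.isCovariantDerivativeOn.add (mdifferentiableAt_coordField a hy)
            (mdifferentiableAt_coordField b hy)]
          ext v
          exact map_add (chartDeriv 𝓘(ℝ, E) x _) _ _
        map_smul' c a := by
          rw [coordField_smul, cov.isCovariantDerivativeOn.smul_const c
            (mdifferentiableAt_coordField a hy)]
          ext v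
          exact map_smul (chartDeriv 𝓘(ℝ, E) x _) c _ }
  else 0

theorem christoffel_apply (hy : y ∈ (chartAt E x).source) (b : E) (v : TangentSpace 𝓘(ℝ, E) y) :
    christoffel cov x (extChartAt 𝓘(ℝ, E) x y) b (chartDeriv 𝓘(ℝ, E) x y v) =
      chartDeriv 𝓘(ℝ, E) x y (cov (coordField x b) y v) := by
  -- The point `y` and its image under the chart followed by the inverse chart have different
  -- tangent space types, so the base point is generalized before substituting.
  have h : ∀ y', y' = y → chartDeriv 𝓘(ℝ, E) x y' (cov (coordField x b) y'
      (chartDerivSymm 𝓘(ℝ, E) x y' (chartDeriv 𝓘(ℝ, E) x y v))) =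
        chartDeriv 𝓘(ℝ, E) x y (cov (coordField x b) y v) := by
    rintro _ rfl
    rw [chartDerivSymm_chartDeriv hy]
  have h2 : (extChartAt 𝓘(ℝ, E) x).symm (extChartAt 𝓘(ℝ, E) x y) = y :=
    (extChartAt 𝓘(ℝ, E) x).left_inv (by simpa using hy)
  unfold christoffel
  rw [dif_pos (by rwa [h2])]
  exact h _ h2

theorem christoffel_symm (htor : cov.torsion = 0) (hy : y ∈ (chartAt E x).source) (a b : E) :
    christoffel cov x (extChartAt 𝓘(ℝ, E) x y) a b =
      christoffel cov x (extChartAt 𝓘(ℝ, E) x y) b a := by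
  have h := cov.torsion_eq_zero_iff.1 htor (mdifferentiableAt_coordField (x := x) b hy)
    (mdifferentiableAt_coordField (x := x) a hy)
  rw [mlieBracket_coordField _ _ hy, sub_eq_zero] at h
  have h1 := christoffel_apply cov hy a (coordField x b y)
  have h2 := christoffel_apply cov hy b (coordField x a y)
  rw [chartDeriv_coordField _ hy] at h1 h2
  rw [h1, h2, h]

theorem contMDiffAt_cov_coordField [T2Space M]
    (hcov : CovariantDerivative.ContMDiffCovariantDerivative cov ∞) (b : E) (x : M) :
    ContMDiffAt 𝓘(ℝ, E) (𝓘(ℝ, E).prod 𝓘(ℝ, E →L[ℝ] E)) ∞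
      (fun z ↦ TotalSpace.mk' (E →L[ℝ] E)
        (E := fun y : M ↦ TangentSpace 𝓘(ℝ, E) y →L[ℝ] TangentSpace 𝓘(ℝ, E) y) z
        (cov (coordField x b) z)) x := by
  -- Smoothness of the connection is applied to a globally smooth field; locality of `cov` transfers
  -- the result to the coordinate field.
  obtain ⟨X, hX, hXe⟩ := exists_isSmoothVectorField_eventuallyEq x b (mem_chart_source E x)
  have h1 := hcov.contMDiff.contMDiff (σ := X) (by simpa using! hX.contMDiffOn)
  refine (h1.contMDiffAt Filter.univ_mem).congr_of_eventuallyEq ?_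
  filter_upwards [hXe.eventually_nhds, (chartAt E x).open_source.mem_nhds (mem_chart_source E x)]
    with z hz hz'
  have : cov (coordField x b) z = cov X z :=
    cov.isCovariantDerivativeOn.congr_of_eventuallyEq (mdifferentiableAt_coordField b hz')
      ((hX z).mdifferentiableAt (by simp)) Filter.univ_mem (hz.mono fun _ h ↦ h.symm)
  rw [this]

theorem contDiffAt_christoffel [T2Space M]
    (hcov : CovariantDerivative.ContMDiffCovariantDerivative cov ∞) (x : M) :
    ContDiffAt ℝ ∞ (christoffel cov x) (extChartAt 𝓘(ℝ, E) x x) := by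
  refine ContDiffAt.of_clm_apply fun b ↦ ?_
  have h1 := ((contMDiffAt_hom_bundle _).1 (contMDiffAt_cov_coordField cov hcov b x)).2
  have h2 := h1.contDiffAt_comp_extChartAt_symm le_rfl (mem_chart_source E x)
  refine h2.congr_of_eventuallyEq ?_
  filter_upwards [extChartAt_target_mem_nhds (I := 𝓘(ℝ, E)) x] with z hz
  have hz' : (extChartAt 𝓘(ℝ, E) x).symm z ∈ (chartAt E x).source := by
    simpa using (extChartAt 𝓘(ℝ, E) x).map_target hz
  unfold christoffel
  rw [dif_pos hz']
  rfl

/-- The covariant derivative of the constant form `α` is tensorial, so it takes the same value on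
`Z` as on the constant-coefficient field that agrees with `Z` at `y`. On the latter the pairing with
`α` is constant, and only the Christoffel term is left. -/
theorem apply_chartDeriv_cov {Z : ∀ y : M, TangentSpace 𝓘(ℝ, E) y}
    (hy : y ∈ (chartAt E x).source)
    (hZ : MDifferentiableAt 𝓘(ℝ, E) (𝓘(ℝ, E).prod 𝓘(ℝ, E)) (fun z ↦ TotalSpace.mk' E z (Z z)) y)
    (α : E →L[ℝ] ℝ) (v : TangentSpace 𝓘(ℝ, E) y) :
    α (chartDeriv 𝓘(ℝ, E) x y (cov Z y v)) =
      mvfderiv 𝓘(ℝ, E) (fun z ↦ α (chartDeriv 𝓘(ℝ, E) x z (Z z))) y v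
        + α (christoffel cov x (extChartAt 𝓘(ℝ, E) x y) (chartDeriv 𝓘(ℝ, E) x y (Z y))
            (chartDeriv 𝓘(ℝ, E) x y v)) := by
  have hα := (smoothOneFormAt_chartForm (J := 𝓘(ℝ, E)) α hy).mdifferentiableAt (by simp)
  have h1 := covDerivOneForm_apply cov hα v hZ
  have h2 := covDerivOneForm_apply cov hα v
    (mdifferentiableAt_coordField (x := x) (chartDeriv 𝓘(ℝ, E) x y (Z y)) hy)
  rw [coordField_chartDeriv hy, h1] at h2
  have h3 : (fun z ↦ chartForm 𝓘(ℝ, E) x α z (coordField x (chartDeriv 𝓘(ℝ, E) x y (Z y)) z))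
      =ᶠ[𝓝 y] fun _ ↦ α (chartDeriv 𝓘(ℝ, E) x y (Z y)) := by
    filter_upwards [(chartAt E x).open_source.mem_nhds hy] with z hz
    exact congrArg α (chartDeriv_coordField _ hz)
  have h4 : mvfderiv 𝓘(ℝ, E) (fun z ↦ chartForm 𝓘(ℝ, E) x α z
      (coordField x (chartDeriv 𝓘(ℝ, E) x y (Z y)) z)) y = 0 := by
    unfold mvfderiv
    rw [h3.mfderiv_eq, mfderiv_const]
    ext; rfl
  rw [h4] at h2
  rw [christoffel_apply cov hy]
  have h5 : mvfderiv 𝓘(ℝ, E) (fun z ↦ α (chartDeriv 𝓘(ℝ, E) x z (Z z))) y v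
    - α (chartDeriv 𝓘(ℝ, E) x y (cov Z y v)) = 0 - α (chartDeriv 𝓘(ℝ, E) x y
      (cov (coordField x (chartDeriv 𝓘(ℝ, E) x y (Z y))) y v)) := h2
  linarith

/-- The covariant derivative in the preferred chart at `x`. -/
theorem chartDeriv_cov {Z : ∀ y : M, TangentSpace 𝓘(ℝ, E) y} (hy : y ∈ (chartAt E x).source)
    (hZ : MDifferentiableAt 𝓘(ℝ, E) (𝓘(ℝ, E).prod 𝓘(ℝ, E)) (fun z ↦ TotalSpace.mk' E z (Z z)) y)
    (v : TangentSpace 𝓘(ℝ, E) y) {Z' : E → E}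
    (hZ' : ∀ᶠ z in 𝓝 y, chartDeriv 𝓘(ℝ, E) x z (Z z) = Z' (extChartAt 𝓘(ℝ, E) x z))
    (hd : DifferentiableAt ℝ Z' (extChartAt 𝓘(ℝ, E) x y)) :
    chartDeriv 𝓘(ℝ, E) x y (cov Z y v) =
      fderiv ℝ Z' (extChartAt 𝓘(ℝ, E) x y) (chartDeriv 𝓘(ℝ, E) x y v)
        + christoffel cov x (extChartAt 𝓘(ℝ, E) x y) (Z' (extChartAt 𝓘(ℝ, E) x y))
            (chartDeriv 𝓘(ℝ, E) x y v) := by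
  refine (SeparatingDual.eq_iff_forall_dual_eq (R := ℝ)).2 fun α ↦ ?_
  rw [apply_chartDeriv_cov cov hy hZ α v, hZ'.self_of_nhds, map_add]
  congr 1
  have h3 : (fun z ↦ α (chartDeriv 𝓘(ℝ, E) x z (Z z))) =ᶠ[𝓝 y]
      fun z ↦ (α ∘ Z') (extChartAt 𝓘(ℝ, E) x z) := hZ'.mono fun z hz ↦ congrArg α hz
  have h4 := (α.hasFDerivAt.comp _ hd.hasFDerivAt).hasMFDerivAt_comp_extChartAt hy
  have h5 := (h4.congr_of_eventuallyEq h3).mfderiv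
  exact DFunLike.congr_fun h5 v

/-- The curvature in the preferred chart at `x`. -/
theorem connectionCurvature_eq_christoffelCurvature [T2Space M]
    (hcov : CovariantDerivative.ContMDiffCovariantDerivative cov ∞) (htor : cov.torsion = 0)
    {X Y Z : ∀ y : M, TangentSpace 𝓘(ℝ, E) y}
    (hX : ContMDiffAt 𝓘(ℝ, E) (𝓘(ℝ, E).prod 𝓘(ℝ, E)) 2 (fun z ↦ TotalSpace.mk' E z (X z)) x)
    (hY : ContMDiffAt 𝓘(ℝ, E) (𝓘(ℝ, E).prod 𝓘(ℝ, E)) 2 (fun z ↦ TotalSpace.mk' E z (Y z)) x)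
    (hZ : ContMDiffAt 𝓘(ℝ, E) (𝓘(ℝ, E).prod 𝓘(ℝ, E)) 2 (fun z ↦ TotalSpace.mk' E z (Z z)) x) :
    chartDeriv 𝓘(ℝ, E) x x (connectionCurvature cov X Y Z x) =
      christoffelCurvature (christoffel cov x) (extChartAt 𝓘(ℝ, E) x x)
        (chartDeriv 𝓘(ℝ, E) x x (X x)) (chartDeriv 𝓘(ℝ, E) x x (Y x))
        (chartDeriv 𝓘(ℝ, E) x x (Z x)) := by
  have hx := mem_chart_source E x
  set c := extChartAt 𝓘(ℝ, E) x x with hc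
  set G := christoffel cov x with hG
  -- the coordinate expression of a `C^2` field
  have rep : ∀ {V : ∀ y : M, TangentSpace 𝓘(ℝ, E) y},
      ContMDiffAt 𝓘(ℝ, E) (𝓘(ℝ, E).prod 𝓘(ℝ, E)) 2 (fun z ↦ TotalSpace.mk' E z (V z)) x →
      ∃ V' : E → E, ContDiffAt ℝ 2 V' c ∧ (∀ y ∈ (chartAt E x).source,
        chartDeriv 𝓘(ℝ, E) x y (V y) = V' (extChartAt 𝓘(ℝ, E) x y)) := by
    intro V hV
    rw [contMDiffAt_section_of_coord (by norm_cast) hx] at hV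
    refine ⟨_, hV.contDiffAt_comp_extChartAt_symm (by norm_cast) hx, fun y hy ↦ ?_⟩
    have h2 : (extChartAt 𝓘(ℝ, E) x).symm (extChartAt 𝓘(ℝ, E) x y) = y :=
      (extChartAt 𝓘(ℝ, E) x).left_inv (by simpa using hy)
    simp only [Function.comp_apply]
    rw [h2]
  obtain ⟨X', hX', eX⟩ := rep hX
  obtain ⟨Y', hY', eY⟩ := rep hY
  obtain ⟨Z', hZ', eZ⟩ := rep hZ
  have ev := (chartAt E x).open_source.mem_nhds hx
  have dX : DifferentiableAt ℝ X' c := hX'.differentiableAt (by simp)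
  have dY : DifferentiableAt ℝ Y' c := hY'.differentiableAt (by simp)
  have dZ : DifferentiableAt ℝ Z' c := hZ'.differentiableAt (by simp)
  have dZ' : DifferentiableAt ℝ (fderiv ℝ Z') c :=
    (hZ'.fderiv_right (m := 1) (by norm_num)).differentiableAt (by simp)
  have dG : DifferentiableAt ℝ G c := (contDiffAt_christoffel cov hcov x).differentiableAt (by simp)
  have dZev : ∀ᶠ z in 𝓝 x, DifferentiableAt ℝ Z' (extChartAt 𝓘(ℝ, E) x z) := by
    have h1 := (hZ'.eventually (by simp)).mono fun z hz ↦ hz.differentiableAt (by simp)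
    exact (continuousAt_extChartAt (I := 𝓘(ℝ, E)) x).eventually h1
  have covZ : ∀ {V : ∀ y : M, TangentSpace 𝓘(ℝ, E) y} {V' : E → E},
      (∀ y ∈ (chartAt E x).source,
        chartDeriv 𝓘(ℝ, E) x y (V y) = V' (extChartAt 𝓘(ℝ, E) x y)) → ∀ᶠ z in 𝓝 x,
      chartDeriv 𝓘(ℝ, E) x z (cov Z z (V z)) =
        (fun y ↦ fderiv ℝ Z' y (V' y) + G y (Z' y) (V' y)) (extChartAt 𝓘(ℝ, E) x z) := by
    intro V V' eV
    filter_upwards [ev, dZev, (contMDiffAt_iff_contMDiffAt_nhds (by simp)).1 hZ] with z hz hdz hZz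
    rw [chartDeriv_cov cov hz (hZz.mdifferentiableAt (by simp)) (V z)
      (Filter.eventually_of_mem ((chartAt E x).open_source.mem_nhds hz) eZ) hdz, eV z hz]
  -- The coordinate formula for `∇_V Z` is itself differentiated along `u`, including its dependence
  -- on `V`.
  have second : ∀ {V : ∀ y : M, TangentSpace 𝓘(ℝ, E) y} {V' : E → E},
      DifferentiableAt ℝ V' c → (∀ y ∈ (chartAt E x).source,
        chartDeriv 𝓘(ℝ, E) x y (V y) = V' (extChartAt 𝓘(ℝ, E) x y)) →
      ∀ (v : TangentSpace 𝓘(ℝ, E) x) (u : E), chartDeriv 𝓘(ℝ, E) x x v = u →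
      chartDeriv 𝓘(ℝ, E) x x (cov (fun y ↦ cov Z y (V y)) x v) =
        fderiv ℝ (fderiv ℝ Z') c u (V' c) + fderiv ℝ Z' c (fderiv ℝ V' c u)
        + (fderiv ℝ G c u (Z' c) (V' c) + G c (fderiv ℝ Z' c u) (V' c)
          + G c (Z' c) (fderiv ℝ V' c u))
        + G c (fderiv ℝ Z' c (V' c) + G c (Z' c) (V' c)) u := by
    intro V V' dV eV v u hu
    have d1 := (dZ'.hasFDerivAt.clm_apply dV.hasFDerivAt).add
      ((dG.hasFDerivAt.clm_apply dZ.hasFDerivAt).clm_apply dV.hasFDerivAt)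
    have hm : MDifferentiableAt 𝓘(ℝ, E) (𝓘(ℝ, E).prod 𝓘(ℝ, E))
        (fun z ↦ TotalSpace.mk' E z (cov Z z (V z))) x := by
      rw [mdifferentiableAt_section_iff_coord hx]
      exact (d1.hasMFDerivAt_comp_extChartAt hx).mdifferentiableAt.congr_of_eventuallyEq (covZ eV)
    have h := chartDeriv_cov cov hx hm v (covZ eV) d1.differentiableAt
    rw [hu, d1.fderiv] at h
    rw [h]
    simp
    abel
  have first : ∀ {V : ∀ y : M, TangentSpace 𝓘(ℝ, E) y} {V' : E → E},
      ContMDiffAt 𝓘(ℝ, E) (𝓘(ℝ, E).prod 𝓘(ℝ, E)) 2 (fun z ↦ TotalSpace.mk' E z (V z)) x →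
      DifferentiableAt ℝ V' c → (∀ y ∈ (chartAt E x).source,
        chartDeriv 𝓘(ℝ, E) x y (V y) = V' (extChartAt 𝓘(ℝ, E) x y)) →
      ∀ v : TangentSpace 𝓘(ℝ, E) x, chartDeriv 𝓘(ℝ, E) x x (cov V x v) =
        fderiv ℝ V' c (chartDeriv 𝓘(ℝ, E) x x v) + G c (V' c) (chartDeriv 𝓘(ℝ, E) x x v) :=
    fun hV dV eV v ↦ chartDeriv_cov cov hx (hV.mdifferentiableAt (by simp)) v
      (Filter.eventually_of_mem ev eV) dV
  -- Vanishing torsion replaces `[X, Y]` by `∇_X Y - ∇_Y X`, so no coordinate formula for the Lie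
  -- bracket is needed. The derivatives of `X`, `Y` and `Z` then cancel, those of second order by
  -- symmetry.
  have htor' := cov.torsion_eq_zero_iff.1 htor (hX.mdifferentiableAt (by simp))
    (hY.mdifferentiableAt (by simp))
  have gsymm : ∀ a b, G c a b = G c b a := christoffel_symm cov htor hx
  unfold connectionCurvature
  rw [← htor', map_sub, map_sub, first hZ dZ eZ, second dY eY _ _ (eX x hx),
    second dX eX _ _ (eY x hx), map_sub, first hX dX eX, first hY dY eY, eX x hx, eY x hx, eZ x hx,
    ← hc, gsymm (Y' c) (X' c)]
  have hsymm := (hZ'.isSymmSndFDerivAt (by simp)).eq (X' c) (Y' c)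
  simp only [christoffelCurvature, map_add, map_sub, add_apply, add_sub_add_right_eq_sub, hsymm]
  abel

end ConnectionInChart

/-! ### The bivector field, its sharp map and the curvature condition in a chart. -/

section BivectorInChart

variable {E : Type*} [NormedAddCommGroup E] [NormedSpace ℝ E]
  {M : Type*} [TopologicalSpace M] [ChartedSpace E M] [IsManifold 𝓘(ℝ, E) ∞ M]

/-- The bivector field `w` in the preferred chart at `x`. -/
def bivectorInChart (w : ContravariantTwoTensor 𝓘(ℝ, E) M) (x : M) (z : E) :
    (E →L[ℝ] ℝ) →L[ℝ] (E →L[ℝ] ℝ) →L[ℝ] ℝ :=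
  (ContinuousLinearMap.precomp ℝ (ContinuousLinearMap.precomp ℝ
    (chartDeriv 𝓘(ℝ, E) x ((extChartAt 𝓘(ℝ, E) x).symm z)))).comp
    ((w ((extChartAt 𝓘(ℝ, E) x).symm z)).comp (ContinuousLinearMap.precomp ℝ
      (chartDeriv 𝓘(ℝ, E) x ((extChartAt 𝓘(ℝ, E) x).symm z))))

theorem bivectorInChart_apply (w : ContravariantTwoTensor 𝓘(ℝ, E) M) (x : M) (z : E)
    (α β : E →L[ℝ] ℝ) : bivectorInChart w x z α β =
      w ((extChartAt 𝓘(ℝ, E) x).symm z)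
        (chartForm 𝓘(ℝ, E) x α ((extChartAt 𝓘(ℝ, E) x).symm z))
        (chartForm 𝓘(ℝ, E) x β ((extChartAt 𝓘(ℝ, E) x).symm z)) := rfl

variable {w : ContravariantTwoTensor 𝓘(ℝ, E) M} {x y : M}

theorem hasChartExpression_bivectorInChart (w : ContravariantTwoTensor 𝓘(ℝ, E) M) (x : M) :
    HasChartExpression w x (bivectorInChart w x) := by
  intro y hy α β
  rw [bivectorInChart_apply, (extChartAt 𝓘(ℝ, E) x).left_inv (by simpa using hy)]

variable [FiniteDimensional ℝ E]

theorem contDiffAt_bivectorInChart (hw : IsBivectorField w) (x : M) :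
    ContDiffAt ℝ ∞ (bivectorInChart w x) (extChartAt 𝓘(ℝ, E) x x) := by
  refine ContDiffAt.of_clm_apply fun α ↦ ContDiffAt.of_clm_apply fun β ↦ ?_
  exact (hw.smooth _ _ x (smoothOneFormAt_chartForm α (mem_chart_source E x))
    (smoothOneFormAt_chartForm β (mem_chart_source E x))).contDiffAt_comp_extChartAt_symm le_rfl
    (mem_chart_source E x)

theorem chartDeriv_bivectorSharp (hy : y ∈ (chartAt E x).source)
    (β : TangentSpace 𝓘(ℝ, E) y →L[ℝ] ℝ) :
    chartDeriv 𝓘(ℝ, E) x y (bivectorSharp w y β) =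
      modelSharp (bivectorInChart w x (extChartAt 𝓘(ℝ, E) x y))
        (β.comp (chartDerivSymm 𝓘(ℝ, E) x y)) := by
  refine (SeparatingDual.eq_iff_forall_dual_eq (R := ℝ)).2 fun α ↦ ?_
  rw [← apply_modelSharp, ← hasChartExpression_bivectorInChart w x y hy, chartForm_coord hy]
  exact apply_sharp w y β (chartForm 𝓘(ℝ, E) x α y)

/-- In the chart `♯β` is a fixed linear map applied to the contraction of two smooth maps. The
curvature formula needs this regularity for the field `♯β`. -/
theorem contMDiffAt_bivectorSharp (hw : IsBivectorField w)
    {β : ∀ y : M, TangentSpace 𝓘(ℝ, E) y →L[ℝ] ℝ} (hβ : SmoothOneFormAt β x) :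
    ContMDiffAt 𝓘(ℝ, E) (𝓘(ℝ, E).prod 𝓘(ℝ, E)) ∞
      (fun y ↦ TotalSpace.mk' E y (bivectorSharp w y (β y))) x := by
  have hx := mem_chart_source E x
  rw [contMDiffAt_section_of_coord le_rfl hx]
  have h1 := (contDiffAt_bivectorInChart hw x).contMDiffAt_comp_extChartAt le_rfl hx
  have h2 := (h1.clm_apply hβ.contMDiffAt_coord)
  have h3 := (bidualInv E).contMDiff.contMDiffAt.comp x h2
  refine h3.congr_of_eventuallyEq ?_
  filter_upwards [(chartAt E x).open_source.mem_nhds hx] with z hz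
  exact chartDeriv_bivectorSharp hz _

variable {cov : CovariantDerivative 𝓘(ℝ, E) E (TangentSpace 𝓘(ℝ, E) : M → Type _)}

/-- A constant-coefficient form pairs to a constant with a constant-coefficient field, so only the
Christoffel term of the covariant derivative remains. -/
theorem covDerivOneForm_chartForm (x : M) (α : E →L[ℝ] ℝ) (v : TangentSpace 𝓘(ℝ, E) x) :
    covDerivOneForm cov ((smoothOneFormAt_chartForm (J := 𝓘(ℝ, E)) α
      (mem_chart_source E x)).mdifferentiableAt (by simp)) v =
    chartForm 𝓘(ℝ, E) x (-α.comp ((christoffel cov x (extChartAt 𝓘(ℝ, E) x x)).flip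
      (chartDeriv 𝓘(ℝ, E) x x v))) x := by
  have hx := mem_chart_source E x
  have hα := (smoothOneFormAt_chartForm (J := 𝓘(ℝ, E)) α hx).mdifferentiableAt (by simp)
  ext u
  have hu := coordField_chartDeriv hx u
  rw [← hu]
  set b := chartDeriv 𝓘(ℝ, E) x x u
  rw [covDerivOneForm_apply cov hα v (mdifferentiableAt_coordField b hx)]
  have h3 : (fun z ↦ chartForm 𝓘(ℝ, E) x α z (coordField x b z)) =ᶠ[𝓝 x] fun _ ↦ α b := by
    filter_upwards [(chartAt E x).open_source.mem_nhds hx] with z hz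
    exact congrArg α (chartDeriv_coordField _ hz)
  have h4 : mvfderiv 𝓘(ℝ, E) (fun z ↦ chartForm 𝓘(ℝ, E) x α z (coordField x b z)) x = 0 := by
    unfold mvfderiv
    rw [h3.mfderiv_eq, mfderiv_const]
    ext; rfl
  have h5 := christoffel_apply cov hx b v
  have h6 := chartDeriv_coordField b hx
  rw [h4]
  simp only [chartForm, ContinuousLinearMap.comp_apply, neg_apply, ContinuousLinearMap.flip_apply,
    h6, h5]
  simp

/-- This is `∇w = 0` evaluated on constant-coefficient forms, whose pairing under `w` is a component
of `w` in the chart. -/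
theorem IsPoissonConnection.fderiv_bivectorInChart (hcov : IsPoissonConnection cov w)
    (hw : IsBivectorField w) (x : M) (t : E) (α β : E →L[ℝ] ℝ) :
    fderiv ℝ (bivectorInChart w x) (extChartAt 𝓘(ℝ, E) x x) t α β =
      -bivectorInChart w x (extChartAt 𝓘(ℝ, E) x x)
          (α.comp ((christoffel cov x (extChartAt 𝓘(ℝ, E) x x)).flip t)) β
        - bivectorInChart w x (extChartAt 𝓘(ℝ, E) x x) α
          (β.comp ((christoffel cov x (extChartAt 𝓘(ℝ, E) x x)).flip t)) := by
  have hx := mem_chart_source E x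
  have h := hcov.parallel _ _ x (smoothOneFormAt_chartForm α hx) (smoothOneFormAt_chartForm β hx)
    (coordField x t x)
  rw [covDerivOneForm_chartForm, covDerivOneForm_chartForm,
    hasChartExpression_bivectorInChart w x x hx, hasChartExpression_bivectorInChart w x x hx,
    chartDeriv_coordField _ hx] at h
  have hd : DifferentiableAt ℝ (bivectorInChart w x) (extChartAt 𝓘(ℝ, E) x x) :=
    (contDiffAt_bivectorInChart hw x).differentiableAt (by simp)
  have h1 := (hd.hasFDerivAt.clm_apply (hasFDerivAt_const α _)).clm_apply (hasFDerivAt_const β _)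
  have h2 : (fun y ↦ w y (chartForm 𝓘(ℝ, E) x α y) (chartForm 𝓘(ℝ, E) x β y)) =ᶠ[𝓝 x]
      fun y ↦ bivectorInChart w x (extChartAt 𝓘(ℝ, E) x y) α β := by
    filter_upwards [(chartAt E x).open_source.mem_nhds hx] with z hz
    exact hasChartExpression_bivectorInChart w x z hz α β
  rw [h1.mvfderiv_apply_of_eventuallyEq hx h2, chartDeriv_coordField _ hx] at h
  simp only [map_neg, neg_apply, add_apply, ContinuousLinearMap.comp_apply,
    ContinuousLinearMap.flip_apply, zero_apply, map_zero, zero_add] at h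
  linarith

theorem eventually_christoffel_symm (htor : cov.torsion = 0) (x : M) :
    ∀ᶠ z in 𝓝 (extChartAt 𝓘(ℝ, E) x x), ∀ u v,
      christoffel cov x z u v = christoffel cov x z v u := by
  filter_upwards [extChartAt_target_mem_nhds (I := 𝓘(ℝ, E)) x] with z hz u v
  have h := christoffel_symm cov htor (x := x)
    (y := (extChartAt 𝓘(ℝ, E) x).symm z) (by simpa using (extChartAt 𝓘(ℝ, E) x).map_target hz) u v
  rwa [(extChartAt 𝓘(ℝ, E) x).right_inv hz] at h

/-- A Poisson connection in coordinates. -/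
theorem IsPoissonConnection.isPoissonChristoffel [T2Space M] (hcov : IsPoissonConnection cov w)
    (hw : IsBivectorField w) (x : M) :
    IsPoissonChristoffel (bivectorInChart w x) (christoffel cov x) (extChartAt 𝓘(ℝ, E) x x) := by
  have h1 := contDiffAt_bivectorInChart hw x
  have h2 := contDiffAt_christoffel cov hcov.smooth x
  have h3 : ∀ α β, bivectorInChart w x (extChartAt 𝓘(ℝ, E) x x) α β =
    -bivectorInChart w x (extChartAt 𝓘(ℝ, E) x x) β α := fun α β ↦ hw.skew _ _ _
  have h4 := eventually_christoffel_symm hcov.torsion_free x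
  have h5 := hcov.fderiv_bivectorInChart hw x
  exact ⟨h1, h2, h3, h4, h5⟩

/-- The curvature condition in coordinates. -/
theorem forall_connectionCurvature_bivectorSharp_iff [T2Space M] (hw : IsBivectorField w)
    (hcov : IsPoissonConnection cov w) :
    (∀ α : ∀ y : M, TangentSpace 𝓘(ℝ, E) y →L[ℝ] ℝ, (∀ x, SmoothOneFormAt α x) →
      ∀ X Y : ∀ y : M, TangentSpace 𝓘(ℝ, E) y, IsSmoothVectorField X → IsSmoothVectorField Y →
        ∀ x : M, connectionCurvature cov X Y (fun y ↦ bivectorSharp w y (α y)) x = 0) ↔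
    ∀ (x : M) (u v : E) (α : E →L[ℝ] ℝ),
      christoffelCurvature (christoffel cov x) (extChartAt 𝓘(ℝ, E) x x) u v
        (modelSharp (bivectorInChart w x (extChartAt 𝓘(ℝ, E) x x)) α) = 0 := by
  have key : ∀ {α : ∀ y : M, TangentSpace 𝓘(ℝ, E) y →L[ℝ] ℝ} {X Y : ∀ y : M, TangentSpace 𝓘(ℝ, E) y},
      (∀ x, SmoothOneFormAt α x) → IsSmoothVectorField X → IsSmoothVectorField Y → ∀ x : M,
      chartDeriv 𝓘(ℝ, E) x x (connectionCurvature cov X Y (fun y ↦ bivectorSharp w y (α y)) x) =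
      christoffelCurvature (christoffel cov x) (extChartAt 𝓘(ℝ, E) x x)
        (chartDeriv 𝓘(ℝ, E) x x (X x)) (chartDeriv 𝓘(ℝ, E) x x (Y x))
        (modelSharp (bivectorInChart w x (extChartAt 𝓘(ℝ, E) x x))
          ((α x).comp (chartDerivSymm 𝓘(ℝ, E) x x))) := by
    intro α X Y hα hX hY x
    rw [connectionCurvature_eq_christoffelCurvature cov hcov.smooth hcov.torsion_free
      ((hX x).of_le (by norm_cast)) ((hY x).of_le (by norm_cast))
      ((contMDiffAt_bivectorSharp hw (hα x)).of_le (by norm_cast)),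
      chartDeriv_bivectorSharp (mem_chart_source E x)]
  constructor
  · intro h x u v α
    have hx := mem_chart_source E x
    -- The condition quantifies over global fields and forms, so the coordinate data `α`, `u`, `v`
    -- are extended by means of bump functions.
    obtain ⟨β, hβ, hβ'⟩ := exists_smoothOneForm_eventuallyEq x α
    obtain ⟨X, hX, hX'⟩ := exists_isSmoothVectorField_eventuallyEq x u hx
    obtain ⟨Y, hY, hY'⟩ := exists_isSmoothVectorField_eventuallyEq x v hx
    have h1 := key hβ hX hY x
    rw [h β hβ X Y hX hY x, hX'.self_of_nhds, hY'.self_of_nhds, hβ'.self_of_nhds,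
      chartDeriv_coordField _ hx, chartDeriv_coordField _ hx, map_zero] at h1
    have h2 : (chartForm 𝓘(ℝ, E) x α x).comp (chartDerivSymm 𝓘(ℝ, E) x x) = α := by
      ext b
      exact congrArg α (chartDeriv_chartDerivSymm hx b)
    rw [h1, h2]
  · intro h α hα X Y hX hY x
    have h1 := key hα hX hY x
    rw [h] at h1
    have h2 := coordField_chartDeriv (mem_chart_source E x)
      (connectionCurvature cov X Y (fun y ↦ bivectorSharp w y (α y)) x)
    rw [h1] at h2
    rw [← h2]
    exact map_zero _

end BivectorInChart

/-! ### The horizontal lift and the canonical Poisson structure in a fixed chart of the cotangent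
bundle. -/

section CotangentChart

variable {E : Type*} [NormedAddCommGroup E] [NormedSpace ℝ E]
  {M : Type*} [TopologicalSpace M] [ChartedSpace E M] [IsManifold 𝓘(ℝ, E) ∞ M]

theorem mem_chartAt_cotangent_source (ξ η : CotangentBundle E M) :
    η ∈ (chartAt (ModelProd E (E →L[ℝ] ℝ)) ξ).source ↔ η.1 ∈ (chartAt E ξ.1).source := by
  rw [← extChartAt_source (cotangentModel E), FiberBundle.extChartAt]
  simp only [mfld_simps]
  constructor
  · intro h
    simpa using h.1
  · intro h
    simp [h]

/-- Both forms have the same constant coefficients in the trivialization at `x`. This identifies the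
local form used to define `horizontalLift`. -/
theorem extend_eventuallyEq_chartForm (x : M) (p : TangentSpace 𝓘(ℝ, E) x →L[ℝ] ℝ) :
    ∀ᶠ z in 𝓝 x, FiberBundle.extend (E →L[ℝ] ℝ)
      (E := fun x : M ↦ TangentSpace 𝓘(ℝ, E) x →L[ℝ] ℝ) p z =
        chartForm 𝓘(ℝ, E) x (p.comp (chartDerivSymm 𝓘(ℝ, E) x x)) z := by
  have key : ∀ z ∈ (chartAt E x).source, ∀ α : E →L[ℝ] ℝ,
      (trivializationAt (E →L[ℝ] ℝ) (fun y : M ↦ TangentSpace 𝓘(ℝ, E) y →L[ℝ] ℝ) x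
        ⟨z, chartForm 𝓘(ℝ, E) x α z⟩).2 = α := by
    intro z hz α
    ext v
    have := chartDeriv_chartDerivSymm (J := 𝓘(ℝ, E)) hz v
    simp only [hom_trivializationAt_apply, ContinuousLinearMap.inCoordinates, chartForm,
      ContinuousLinearMap.comp_apply, this]
    simp
  have hx := mem_chart_source E x
  filter_upwards [(chartAt E x).open_source.mem_nhds hx] with z hz
  have h1 := key x hx (p.comp (chartDerivSymm 𝓘(ℝ, E) x x))
  rw [chartForm_coord hx] at h1
  have h2 := key z hz (p.comp (chartDerivSymm 𝓘(ℝ, E) x x))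
  have h3 := (trivializationAt (E →L[ℝ] ℝ) (fun y : M ↦ TangentSpace 𝓘(ℝ, E) y →L[ℝ] ℝ)
    x).symm_proj_apply ⟨z, chartForm 𝓘(ℝ, E) x (p.comp (chartDerivSymm 𝓘(ℝ, E) x x)) z⟩
    (by simpa using hz)
  unfold FiberBundle.extend
  rw [h1]
  rw [h2] at h3
  exact h3

variable [FiniteDimensional ℝ E]
  (cov : CovariantDerivative 𝓘(ℝ, E) E (TangentSpace 𝓘(ℝ, E) : M → Type _))

theorem covDerivOneForm_extend_coordField (x : M) (p : TangentSpace 𝓘(ℝ, E) x →L[ℝ] ℝ)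
    (v : TangentSpace 𝓘(ℝ, E) x) (b : E) :
    covDerivOneForm cov (FiberBundle.mdifferentiableAt_extend 𝓘(ℝ, E) (E →L[ℝ] ℝ)
      (V := fun y : M ↦ TangentSpace 𝓘(ℝ, E) y →L[ℝ] ℝ) p) v (coordField x b x) =
      -p (cov (coordField x b) x v) := by
  have hx := mem_chart_source E x
  rw [covDerivOneForm_apply cov _ v (mdifferentiableAt_coordField b hx)]
  have h3 : (fun z ↦ FiberBundle.extend (E →L[ℝ] ℝ)
      (E := fun x : M ↦ TangentSpace 𝓘(ℝ, E) x →L[ℝ] ℝ) p z (coordField x b z)) =ᶠ[𝓝 x]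
      fun _ ↦ p.comp (chartDerivSymm 𝓘(ℝ, E) x x) b := by
    filter_upwards [(chartAt E x).open_source.mem_nhds hx, extend_eventuallyEq_chartForm x p]
      with z hz hz'
    rw [hz']
    exact congrArg (p.comp (chartDerivSymm 𝓘(ℝ, E) x x)) (chartDeriv_coordField _ hz)
  have h4 : mvfderiv 𝓘(ℝ, E) (fun z ↦ FiberBundle.extend (E →L[ℝ] ℝ)
      (E := fun x : M ↦ TangentSpace 𝓘(ℝ, E) x →L[ℝ] ℝ) p z (coordField x b z)) x = 0 := by
    unfold mvfderiv
    rw [h3.mfderiv_eq, mfderiv_const]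
    ext; rfl
  rw [h4, FiberBundle.extend_apply_self]
  simp

theorem cov_coordField_symm (htor : cov.torsion = 0) {x y : M} (hy : y ∈ (chartAt E x).source)
    (a b : E) : cov (coordField x a) y (coordField x b y) =
      cov (coordField x b) y (coordField x a y) := by
  have h := cov.torsion_eq_zero_iff.1 htor (mdifferentiableAt_coordField (x := x) b hy)
    (mdifferentiableAt_coordField (x := x) a hy)
  rwa [mlieBracket_coordField _ _ hy, sub_eq_zero] at h

/-- A form with constant coefficients is closed, and for a torsion-free connection the covariant
derivative of a closed form is symmetric. Here this comes down to the symmetry of the Christoffel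
symbol. -/
theorem covDerivOneForm_extend_symm (htor : cov.torsion = 0) (x : M)
    (p : TangentSpace 𝓘(ℝ, E) x →L[ℝ] ℝ) (u v : TangentSpace 𝓘(ℝ, E) x) :
    covDerivOneForm cov (FiberBundle.mdifferentiableAt_extend 𝓘(ℝ, E) (E →L[ℝ] ℝ)
      (V := fun y : M ↦ TangentSpace 𝓘(ℝ, E) y →L[ℝ] ℝ) p) u v =
    covDerivOneForm cov (FiberBundle.mdifferentiableAt_extend 𝓘(ℝ, E) (E →L[ℝ] ℝ)
      (V := fun y : M ↦ TangentSpace 𝓘(ℝ, E) y →L[ℝ] ℝ) p) v u := by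
  have hx := mem_chart_source E x
  rw [← coordField_chartDeriv hx u, ← coordField_chartDeriv hx v,
    covDerivOneForm_extend_coordField, covDerivOneForm_extend_coordField,
    cov_coordField_symm cov htor hx]

/-- A linear function of the canonical coordinates is a function of the base point plus the momentum
of a coordinate field. In this form it can be differentiated along fibres and along sections without
a change of charts. -/
theorem hasMFDerivAt_apply_extChartAt_cotangent {ξ η : CotangentBundle E M}
    (hη : η.1 ∈ (chartAt E ξ.1).source) (Φ : E × (E →L[ℝ] ℝ) →L[ℝ] ℝ) :
    HasMFDerivAt (cotangentModel E) 𝓘(ℝ, ℝ) (fun ζ : CotangentBundle E M ↦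
        Φ (extChartAt 𝓘(ℝ, E) ξ.1 ζ.1, 0) + ζ.2 (coordField ξ.1 (verticalPart Φ) ζ.1)) η
      (chartForm (cotangentModel E) ξ Φ η) := by
  have h1 := (Φ.hasFDerivAt (x := extChartAt (cotangentModel E) ξ η)).hasMFDerivAt_comp_extChartAt
    ((mem_chartAt_cotangent_source ξ η).2 hη)
  refine h1.congr_of_eventuallyEq (Filter.Eventually.of_forall fun ζ ↦ ?_)
  have h2 : ζ.2 (coordField ξ.1 (verticalPart Φ) ζ.1) =
      (ζ.2.comp (chartDerivSymm 𝓘(ℝ, E) ξ.1 ζ.1)) (verticalPart Φ) := rfl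
  dsimp only
  rw [h2, apply_verticalPart, ← map_add, extChartAt_cotangent_apply]
  simp

/-- The differentials of canonical coordinates on vertical vectors. -/
theorem chartForm_cotangent_inr {ξ η : CotangentBundle E M}
    (hη : η.1 ∈ (chartAt E ξ.1).source) (Φ : E × (E →L[ℝ] ℝ) →L[ℝ] ℝ) (q : E →L[ℝ] ℝ) :
    chartForm (cotangentModel E) ξ Φ η (show E × (E →L[ℝ] ℝ) from (0, q)) =
      q (coordField ξ.1 (verticalPart Φ) η.1) := by
  obtain ⟨-, h2⟩ := hasMFDerivAt_comp_cotangent (E := E) (G := ℝ) η.1 η.2 _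
    (hasMFDerivAt_apply_extChartAt_cotangent hη Φ)
  have h3 := ((ContinuousLinearMap.apply ℝ ℝ
    (show E from coordField ξ.1 (verticalPart Φ) η.1)).hasFDerivAt (x := η.2)).const_add
      (Φ (extChartAt 𝓘(ℝ, E) ξ.1 η.1, 0))
  exact DFunLike.congr_fun (hasMFDerivAt_unique h2 h3.hasMFDerivAt) q

/-- The differentials of canonical coordinates along the sections which are constant in the
canonical coordinates around another point. -/
theorem chartForm_cotangent_inl {ξ η : CotangentBundle E M}
    (hη : η.1 ∈ (chartAt E ξ.1).source) (Φ : E × (E →L[ℝ] ℝ) →L[ℝ] ℝ) (v : E) :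
    chartForm (cotangentModel E) ξ Φ η (show E × (E →L[ℝ] ℝ) from (v, 0)) =
      Φ (chartDeriv 𝓘(ℝ, E) ξ.1 η.1 v, 0)
      + covDerivOneForm cov (FiberBundle.mdifferentiableAt_extend 𝓘(ℝ, E) (E →L[ℝ] ℝ)
        (V := fun y : M ↦ TangentSpace 𝓘(ℝ, E) y →L[ℝ] ℝ) η.2) v
          (coordField ξ.1 (verticalPart Φ) η.1)
      + η.2 (cov (coordField ξ.1 (verticalPart Φ)) η.1 v) := by
  obtain ⟨h1, -⟩ := hasMFDerivAt_comp_cotangent (E := E) (G := ℝ) η.1 η.2 _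
    (hasMFDerivAt_apply_extChartAt_cotangent hη Φ)
  have hX := mdifferentiableAt_coordField (verticalPart Φ) hη
  have h3 := covDerivOneForm_apply cov (FiberBundle.mdifferentiableAt_extend 𝓘(ℝ, E) (E →L[ℝ] ℝ)
    (V := fun y : M ↦ TangentSpace 𝓘(ℝ, E) y →L[ℝ] ℝ) η.2) v hX
  rw [FiberBundle.extend_apply_self] at h3
  have h4 : MDifferentiableAt 𝓘(ℝ, E) 𝓘(ℝ, ℝ) (fun y : M ↦ FiberBundle.extend (E →L[ℝ] ℝ)
      (E := fun y : M ↦ TangentSpace 𝓘(ℝ, E) y →L[ℝ] ℝ) η.2 y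
        (coordField ξ.1 (verticalPart Φ) y)) η.1 := by
    have := (FiberBundle.mdifferentiableAt_extend 𝓘(ℝ, E) (E →L[ℝ] ℝ)
      (V := fun y : M ↦ TangentSpace 𝓘(ℝ, E) y →L[ℝ] ℝ) η.2).clm_bundle_apply
        (F₁ := E) (F₂ := ℝ) (E₂ := Trivial M ℝ) hX
    rw [mdifferentiableAt_totalSpace] at this
    exact this.2
  have h5 := ((Φ.comp (ContinuousLinearMap.inl ℝ E (E →L[ℝ] ℝ))).hasFDerivAt
    (x := extChartAt 𝓘(ℝ, E) ξ.1 η.1)).hasMFDerivAt_comp_extChartAt hη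
  -- The derivative of the pairing of the section with the coordinate field is split by the Leibniz
  -- rule for `cov`, in the form `h3`.
  have h6 := DFunLike.congr_fun (hasMFDerivAt_unique h1 (h5.add h4.hasMFDerivAt)) v
  have h7 : mfderiv 𝓘(ℝ, E) 𝓘(ℝ, ℝ) (fun y : M ↦ FiberBundle.extend (E →L[ℝ] ℝ)
      (E := fun y : M ↦ TangentSpace 𝓘(ℝ, E) y →L[ℝ] ℝ) η.2 y
        (coordField ξ.1 (verticalPart Φ) y)) η.1 v = _ := (sub_eq_iff_eq_add.1 h3.symm)
  rw [add_assoc]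
  exact h6.trans (congrArg (Φ (chartDeriv 𝓘(ℝ, E) ξ.1 η.1 v, 0) + ·) h7)

/-- With `σ` the section with constant coefficients in the chart at `η`, the lift of `v` is `(v,
-∇_v σ)`. The term `∇_v σ` produced by the first component cancels against the second, so nothing
depends on the chart at `η` any more. -/
theorem chartForm_comp_horizontalLift {ξ η : CotangentBundle E M}
    (hη : η.1 ∈ (chartAt E ξ.1).source) (Φ : E × (E →L[ℝ] ℝ) →L[ℝ] ℝ) :
    (chartForm (cotangentModel E) ξ Φ η).comp (horizontalLift cov η) =
      chartForm 𝓘(ℝ, E) ξ.1 (horizontalPart (christoffel cov ξ.1)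
        (extChartAt (cotangentModel E) ξ η) Φ) η.1 := by
  apply ContinuousLinearMap.ext
  intro v
  have h1 := clm_prod_apply_neg (G₁ := E) (G₂ := E →L[ℝ] ℝ) (G₃ := ℝ)
    (chartForm (cotangentModel E) ξ Φ η) v (covDerivOneForm cov
      (FiberBundle.mdifferentiableAt_extend 𝓘(ℝ, E) (E →L[ℝ] ℝ)
        (V := fun y : M ↦ TangentSpace 𝓘(ℝ, E) y →L[ℝ] ℝ) η.2) v)
  have h2 := chartForm_cotangent_inl cov hη Φ v
  have h3 := chartForm_cotangent_inr hη Φ (covDerivOneForm cov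
      (FiberBundle.mdifferentiableAt_extend 𝓘(ℝ, E) (E →L[ℝ] ℝ)
        (V := fun y : M ↦ TangentSpace 𝓘(ℝ, E) y →L[ℝ] ℝ) η.2) v)
  have h4 : horizontalPart (christoffel cov ξ.1) (extChartAt (cotangentModel E) ξ η) Φ
      (chartDeriv 𝓘(ℝ, E) ξ.1 η.1 v) = Φ (chartDeriv 𝓘(ℝ, E) ξ.1 η.1 v, 0)
        + η.2 (cov (coordField ξ.1 (verticalPart Φ)) η.1 v) := by
    have h5 := christoffel_apply cov hη (verticalPart Φ) v
    have h6 := chartDerivSymm_chartDeriv hη (cov (coordField ξ.1 (verticalPart Φ)) η.1 v)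
    rw [horizontalPart_apply, extChartAt_cotangent_apply]
    exact congrArg (Φ (chartDeriv 𝓘(ℝ, E) ξ.1 η.1 v, 0) + ·)
      (((congrArg (η.2.comp (chartDerivSymm 𝓘(ℝ, E) ξ.1 η.1)) h5)).trans (congrArg η.2 h6))
  have h7 := h1.trans (congrArg₂ (· - ·) h2 h3)
  have h8 : ∀ r s t : ℝ, r + s + t - s = r + t := fun r s t ↦ by ring
  exact (h7.trans (h8 _ _ _)).trans h4.symm

theorem hasChartExpression_horizontalLiftTensor (w : ContravariantTwoTensor 𝓘(ℝ, E) M)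
    (ξ : CotangentBundle E M) : HasChartExpression (horizontalLiftTensor cov w) ξ
      (liftModel (bivectorInChart w ξ.1) (christoffel cov ξ.1)) := by
  intro η hη Φ Ψ
  have hη' := (mem_chartAt_cotangent_source ξ η).1 hη
  rw [horizontalLiftTensor_apply, chartForm_comp_horizontalLift cov hη',
    chartForm_comp_horizontalLift cov hη', hasChartExpression_bivectorInChart w ξ.1 _ hη',
    liftModel_apply, extChartAt_cotangent_apply]
  rfl

variable {cov} in
-- `W_0` does not involve the connection, which serves here as an auxiliary tool: the change of
-- charts contributes `∇σ` and `∇X` terms, both symmetric when the torsion vanishes, and they drop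
-- out by antisymmetry.
theorem hasChartExpression_canonicalPoisson (htor : cov.torsion = 0) (ξ : CotangentBundle E M) :
    HasChartExpression (canonicalPoisson E M) ξ (fun _ ↦ canonicalModel E) := by
  intro η hη Φ Ψ
  have hη' := (mem_chartAt_cotangent_source ξ η).1 hη
  have key : ∀ Φ Ψ : E × (E →L[ℝ] ℝ) →L[ℝ] ℝ, chartForm (cotangentModel E) ξ Φ η
      (show E × (E →L[ℝ] ℝ) from (0, ContinuousLinearMap.comp (M₁ := E)
        (M₂ := E × (E →L[ℝ] ℝ)) (M₃ := ℝ) (chartForm (cotangentModel E) ξ Ψ η)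
        (ContinuousLinearMap.inl ℝ E (E →L[ℝ] ℝ)))) =
      Φ (0, Ψ.comp (ContinuousLinearMap.inl ℝ E (E →L[ℝ] ℝ)))
      + covDerivOneForm cov (FiberBundle.mdifferentiableAt_extend 𝓘(ℝ, E) (E →L[ℝ] ℝ)
        (V := fun y : M ↦ TangentSpace 𝓘(ℝ, E) y →L[ℝ] ℝ) η.2)
          (coordField ξ.1 (verticalPart Φ) η.1) (coordField ξ.1 (verticalPart Ψ) η.1)
      + η.2 (cov (coordField ξ.1 (verticalPart Ψ)) η.1
          (coordField ξ.1 (verticalPart Φ) η.1)) := by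
    intro Φ Ψ
    rw [chartForm_cotangent_inr hη', ← apply_verticalPart Φ]
    refine (chartForm_cotangent_inl cov hη' Ψ (coordField ξ.1 (verticalPart Φ) η.1)).trans ?_
    have := chartDeriv_coordField (verticalPart Φ) hη'
    rw [this]
    rfl
  have h1 := canonicalPoisson_apply η (chartForm (cotangentModel E) ξ Φ η)
    (chartForm (cotangentModel E) ξ Ψ η)
  refine h1.trans ?_
  refine (congrArg₂ (· - ·) (key Φ Ψ) (key Ψ Φ)).trans ?_
  rw [canonicalModel_apply, covDerivOneForm_extend_symm cov htor, cov_coordField_symm cov htor hη']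
  ring

end CotangentChart

/-! ### Poisson and Schouten brackets in a chart. -/

section BracketInChart

variable {F : Type*} [NormedAddCommGroup F] [NormedSpace ℝ F]
  {H : Type*} [TopologicalSpace H] {J : ModelWithCorners ℝ F H} [J.Boundaryless]
  {N : Type*} [TopologicalSpace N] [ChartedSpace H N] [IsManifold J ∞ N]
  {P P₁ P₂ : ContravariantTwoTensor J N} {x y : N}
  {Q Q₁ Q₂ : F → (F →L[ℝ] ℝ) →L[ℝ] (F →L[ℝ] ℝ) →L[ℝ] ℝ} {f g h : N → ℝ}

theorem HasChartExpression.poissonBracket_eq (hP : HasChartExpression P x Q)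
    (hy : y ∈ (chartAt H x).source) (hf : MDifferentiableAt J 𝓘(ℝ, ℝ) f y)
    (hg : MDifferentiableAt J 𝓘(ℝ, ℝ) g y) :
    poissonBracket P f g y = vectorSpaceBracket Q (f ∘ (extChartAt J x).symm)
      (g ∘ (extChartAt J x).symm) (extChartAt J x y) := by
  unfold poissonBracket
  rw [mvfderiv_eq_fderiv hy hf, mvfderiv_eq_fderiv hy hg]
  exact hP y hy _ _

theorem HasChartExpression.poissonBracket_eventuallyEq (hP : HasChartExpression P x Q)
    (hf : ContMDiff J 𝓘(ℝ, ℝ) ∞ f) (hg : ContMDiff J 𝓘(ℝ, ℝ) ∞ g) :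
    poissonBracket P f g =ᶠ[𝓝 x] fun y ↦ vectorSpaceBracket Q (f ∘ (extChartAt J x).symm)
      (g ∘ (extChartAt J x).symm) (extChartAt J x y) := by
  filter_upwards [(chartAt H x).open_source.mem_nhds (mem_chart_source H x)] with y hy
  exact hP.poissonBracket_eq hy ((hf y).mdifferentiableAt (by simp))
    ((hg y).mdifferentiableAt (by simp))

/-- Iterated Poisson brackets in a chart. -/
theorem HasChartExpression.poissonBracket_poissonBracket (h₁ : HasChartExpression P₁ x Q₁)
    (h₂ : HasChartExpression P₂ x Q₂) (hQ₁ : DifferentiableAt ℝ Q₁ (extChartAt J x x))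
    (hf : ContMDiff J 𝓘(ℝ, ℝ) ∞ f) (hg : ContMDiff J 𝓘(ℝ, ℝ) ∞ g)
    (hh : ContMDiff J 𝓘(ℝ, ℝ) ∞ h) :
    poissonBracket P₂ (poissonBracket P₁ f g) h x =
      vectorSpaceBracket Q₂ (vectorSpaceBracket Q₁ (f ∘ (extChartAt J x).symm)
        (g ∘ (extChartAt J x).symm)) (h ∘ (extChartAt J x).symm) (extChartAt J x x) := by
  have hx := mem_chart_source H x
  have hf' := ((hf x).of_le (m := 2) (by norm_cast)).contDiffAt_comp_extChartAt_symm (J := J)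
    (by norm_cast) hx
  have hg' := ((hg x).of_le (m := 2) (by norm_cast)).contDiffAt_comp_extChartAt_symm (J := J)
    (by norm_cast) hx
  have h0 := differentiableAt_vectorSpaceBracket hQ₁ hf' hg'
  have e := h₁.poissonBracket_eventuallyEq hf hg
  have h3 := (h0.hasFDerivAt.hasMFDerivAt_comp_extChartAt hx).congr_of_eventuallyEq e
  unfold poissonBracket at h3 ⊢
  have h4 : mvfderiv J (fun y ↦ P₁ y (mvfderiv J f y) (mvfderiv J g y)) x = _ := h3.mfderiv
  rw [h4, mvfderiv_eq_fderiv hx ((hh x).mdifferentiableAt (by simp))]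
  exact h₂ x hx _ _

/-- The Schouten bracket in a chart. -/
theorem HasChartExpression.schoutenBracket_eq (h₁ : HasChartExpression P₁ x Q₁)
    (h₂ : HasChartExpression P₂ x Q₂) (hQ₁ : DifferentiableAt ℝ Q₁ (extChartAt J x x))
    (hQ₂ : DifferentiableAt ℝ Q₂ (extChartAt J x x))
    (hf : ContMDiff J 𝓘(ℝ, ℝ) ∞ f) (hg : ContMDiff J 𝓘(ℝ, ℝ) ∞ g)
    (hh : ContMDiff J 𝓘(ℝ, ℝ) ∞ h)
    (skew₁ : ∀ Φ Ψ, Q₁ (extChartAt J x x) Φ Ψ = -Q₁ (extChartAt J x x) Ψ Φ)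
    (skew₂ : ∀ Φ Ψ, Q₂ (extChartAt J x x) Φ Ψ = -Q₂ (extChartAt J x x) Ψ Φ)
    {S₁ S₂ : (F →L[ℝ] ℝ) → F}
    (hS₁ : ∀ Φ Ψ, Q₁ (extChartAt J x x) Φ Ψ = Φ (S₁ Ψ))
    (hS₂ : ∀ Φ Ψ, Q₂ (extChartAt J x x) Φ Ψ = Φ (S₂ Ψ)) {Φ Ψ Θ : F →L[ℝ] ℝ}
    (hΦ : fderiv ℝ (f ∘ (extChartAt J x).symm) (extChartAt J x x) = Φ)
    (hΨ : fderiv ℝ (g ∘ (extChartAt J x).symm) (extChartAt J x x) = Ψ)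
    (hΘ : fderiv ℝ (h ∘ (extChartAt J x).symm) (extChartAt J x x) = Θ) :
    schoutenBracket P₁ P₂ f g h x =
      fderiv ℝ Q₁ (extChartAt J x x) (S₂ Θ) Φ Ψ + fderiv ℝ Q₁ (extChartAt J x x) (S₂ Φ) Ψ Θ
        + fderiv ℝ Q₁ (extChartAt J x x) (S₂ Ψ) Θ Φ
        + (fderiv ℝ Q₂ (extChartAt J x x) (S₁ Θ) Φ Ψ + fderiv ℝ Q₂ (extChartAt J x x) (S₁ Φ) Ψ Θ
        + fderiv ℝ Q₂ (extChartAt J x x) (S₁ Ψ) Θ Φ) := by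
  have hx := mem_chart_source H x
  have smooth : ∀ {f : N → ℝ}, ContMDiff J 𝓘(ℝ, ℝ) ∞ f →
      ContDiffAt ℝ 2 (f ∘ (extChartAt J x).symm) (extChartAt J x x) := fun hf ↦
    ((hf x).of_le (by norm_cast)).contDiffAt_comp_extChartAt_symm (by norm_cast) hx
  have key := schouten_vectorSpaceBracket hQ₁ hQ₂ skew₁ skew₂ hS₁ hS₂ (smooth hf) (smooth hg)
    (smooth hh)
  rw [hΦ, hΨ, hΘ] at key
  unfold schoutenBracket
  rw [h₁.poissonBracket_poissonBracket h₂ hQ₁ hf hg hh,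
    h₁.poissonBracket_poissonBracket h₂ hQ₁ hg hh hf,
    h₁.poissonBracket_poissonBracket h₂ hQ₁ hh hf hg,
    h₂.poissonBracket_poissonBracket h₁ hQ₂ hf hg hh,
    h₂.poissonBracket_poissonBracket h₁ hQ₂ hg hh hf,
    h₂.poissonBracket_poissonBracket h₁ hQ₂ hh hf hg]
  linarith

theorem HasChartExpression.contMDiffAt_apply [FiniteDimensional ℝ F]
    (hP : HasChartExpression P x Q)
    (hQ : ContDiffAt ℝ ∞ Q (extChartAt J x x)) {α β : ∀ y : N, TangentSpace J y →L[ℝ] ℝ}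
    (hα : SmoothOneFormAt α x) (hβ : SmoothOneFormAt β x) :
    ContMDiffAt J 𝓘(ℝ, ℝ) ∞ (fun y ↦ P y (α y) (β y)) x := by
  have hx := mem_chart_source H x
  have h1 := hQ.contMDiffAt_comp_extChartAt le_rfl hx
  have h2 := (h1.clm_apply hα.contMDiffAt_coord).clm_apply hβ.contMDiffAt_coord
  refine h2.congr_of_eventuallyEq ?_
  filter_upwards [(chartAt H x).open_source.mem_nhds hx] with y hy
  rw [← hP y hy, chartForm_coord hy, chartForm_coord hy]

end BracketInChart

/-! ### The brackets `[w^H, w^H]` and `[w^H, W_0]` on the cotangent bundle. -/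

section HorizontalLift

variable {E : Type*} [NormedAddCommGroup E] [NormedSpace ℝ E]
  {M : Type*} [TopologicalSpace M] [ChartedSpace E M] [IsManifold 𝓘(ℝ, E) ∞ M]

theorem extChartAt_cotangent_self (ξ : CotangentBundle E M) :
    extChartAt (cotangentModel E) ξ ξ =
      (extChartAt 𝓘(ℝ, E) ξ.1 ξ.1, ξ.2.comp (chartDerivSymm 𝓘(ℝ, E) ξ.1 ξ.1)) :=
  extChartAt_cotangent_apply ξ ξ

variable [FiniteDimensional ℝ E] [T2Space M]

/-- Smooth functions on `T*M` can have any differential at a given point. -/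
theorem exists_contMDiff_cotangent_fderiv_eq (ξ : CotangentBundle E M)
    (Φ : E × (E →L[ℝ] ℝ) →L[ℝ] ℝ) : ∃ f : CotangentBundle E M → ℝ,
      ContMDiff (cotangentModel E) 𝓘(ℝ, ℝ) ∞ f ∧
        fderiv ℝ (f ∘ (extChartAt (cotangentModel E) ξ).symm)
          (extChartAt (cotangentModel E) ξ ξ) = Φ := by
  obtain ⟨ρ, -, hρ⟩ := (SmoothBumpFunction.nhds_basis_tsupport (I := 𝓘(ℝ, E)) ξ.1).mem_iff.1
    ((chartAt E ξ.1).open_source.mem_nhds (mem_chart_source E ξ.1))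
  have hπ : ContMDiff (cotangentModel E) 𝓘(ℝ, E) ∞ (TotalSpace.proj : CotangentBundle E M → M) :=
    contMDiff_proj _
  have hc : Continuous (TotalSpace.proj : CotangentBundle E M → M) := hπ.continuous
  -- The chart domain in `T*M` is the full preimage of the one in `M`, so a cutoff depending on the
  -- base point alone is enough.
  refine ⟨fun η ↦ ρ η.1 * Φ (extChartAt (cotangentModel E) ξ η), fun η ↦ ?_, ?_⟩
  · by_cases hη : η.1 ∈ tsupport ρ
    · have h1 : ContMDiffAt (cotangentModel E) 𝓘(ℝ, ℝ) ∞
          (fun η : CotangentBundle E M ↦ ρ η.1) η :=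
        ρ.contMDiff.contMDiffAt.comp η (hπ η)
      exact h1.mul (Φ.contDiff.contDiffAt.contMDiffAt_comp_extChartAt le_rfl
        ((mem_chartAt_cotangent_source ξ η).2 (hρ hη)))
    · refine (contMDiffAt_const (c := (0 : ℝ))).congr_of_eventuallyEq ?_
      filter_upwards [hc.continuousAt.eventually
        ((isClosed_tsupport ρ).isOpen_compl.mem_nhds hη)] with ζ hζ
      rw [image_eq_zero_of_notMem_tsupport hζ, zero_mul]
  · have h1 : ∀ᶠ z in 𝓝 (extChartAt (cotangentModel E) ξ ξ),
        ρ ((extChartAt (cotangentModel E) ξ).symm z).1 = 1 := by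
      have h2 := (hc.continuousAt (x := ξ)).eventually ρ.eventuallyEq_one
      have h3 := continuousAt_extChartAt_symm (I := cotangentModel E) ξ
      unfold ContinuousAt at h3
      rw [extChartAt_to_inv] at h3
      exact h3.eventually h2
    have h4 : (fun η ↦ ρ η.1 * Φ (extChartAt (cotangentModel E) ξ η)) ∘
        (extChartAt (cotangentModel E) ξ).symm =ᶠ[𝓝 (extChartAt (cotangentModel E) ξ ξ)] Φ := by
      filter_upwards [h1, extChartAt_target_mem_nhds (I := cotangentModel E) ξ] with z hz hz'
      simp only [Function.comp_apply]
      rw [hz, (extChartAt (cotangentModel E) ξ).right_inv hz', one_mul]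
    rw [h4.fderiv_eq, Φ.fderiv]

variable {w : ContravariantTwoTensor 𝓘(ℝ, E) M}
  {cov : CovariantDerivative 𝓘(ℝ, E) E (TangentSpace 𝓘(ℝ, E) : M → Type _)}

theorem IsPoissonConnection.contDiffAt_liftModel (hcov : IsPoissonConnection cov w)
    (hw : IsBivectorField w) (ξ : CotangentBundle E M) :
    ContDiffAt ℝ ∞ (liftModel (bivectorInChart w ξ.1) (christoffel cov ξ.1))
      (extChartAt (cotangentModel E) ξ ξ) := by
  rw [extChartAt_cotangent_self]
  exact _root_.contDiffAt_liftModel (contDiffAt_bivectorInChart hw ξ.1)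
    (contDiffAt_christoffel cov hcov.smooth ξ.1)

theorem IsPoissonConnection.isBivectorField_horizontalLiftTensor (hcov : IsPoissonConnection cov w)
    (hw : IsBivectorField w) : IsBivectorField (horizontalLiftTensor cov w) where
  smooth _ _ ξ hα hβ := (hasChartExpression_horizontalLiftTensor cov w ξ).contMDiffAt_apply
    (hcov.contDiffAt_liftModel hw ξ) hα hβ
  skew ξ _ _ := hw.skew ξ.1 _ _

variable {f g h : CotangentBundle E M → ℝ}

/-- `[w^H, w^H]` in canonical coordinates. -/
theorem IsPoissonConnection.schoutenBracket_horizontalLiftTensor_self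
    (hcov : IsPoissonConnection cov w) (hw : IsBivectorField w) (ξ : CotangentBundle E M)
    (hf : ContMDiff (cotangentModel E) 𝓘(ℝ, ℝ) ∞ f)
    (hg : ContMDiff (cotangentModel E) 𝓘(ℝ, ℝ) ∞ g)
    (hh : ContMDiff (cotangentModel E) 𝓘(ℝ, ℝ) ∞ h) :
    ∃ α β γ : E →L[ℝ] ℝ, ∃ a b c : E,
    schoutenBracket (horizontalLiftTensor cov w) (horizontalLiftTensor cov w) f g h ξ =
      2 * (ξ.2.comp (chartDerivSymm 𝓘(ℝ, E) ξ.1 ξ.1)) (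
        christoffelCurvature (christoffel cov ξ.1) (extChartAt 𝓘(ℝ, E) ξ.1 ξ.1)
          (modelSharp (bivectorInChart w ξ.1 (extChartAt 𝓘(ℝ, E) ξ.1 ξ.1)) γ)
          (modelSharp (bivectorInChart w ξ.1 (extChartAt 𝓘(ℝ, E) ξ.1 ξ.1)) β) a
        + christoffelCurvature (christoffel cov ξ.1) (extChartAt 𝓘(ℝ, E) ξ.1 ξ.1)
          (modelSharp (bivectorInChart w ξ.1 (extChartAt 𝓘(ℝ, E) ξ.1 ξ.1)) α)
          (modelSharp (bivectorInChart w ξ.1 (extChartAt 𝓘(ℝ, E) ξ.1 ξ.1)) γ) b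
        + christoffelCurvature (christoffel cov ξ.1) (extChartAt 𝓘(ℝ, E) ξ.1 ξ.1)
          (modelSharp (bivectorInChart w ξ.1 (extChartAt 𝓘(ℝ, E) ξ.1 ξ.1)) β)
          (modelSharp (bivectorInChart w ξ.1 (extChartAt 𝓘(ℝ, E) ξ.1 ξ.1)) α) c) := by
  have hP := hcov.isPoissonChristoffel hw ξ.1
  have hd := (hcov.contDiffAt_liftModel hw ξ).differentiableAt (by simp)
  have hC := hasChartExpression_horizontalLiftTensor cov w ξ
  -- The skewness and Hamiltonian hypotheses stay as arguments, so that the chart image of `ξ` can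
  -- be rewritten as a pair in all of them at once. The `set` lines protect the differentials from
  -- that rewriting.
  have h1 := fun s₁ s₂ (S : (E × (E →L[ℝ] ℝ) →L[ℝ] ℝ) → E × (E →L[ℝ] ℝ))
      (hS : ∀ Φ Ψ : E × (E →L[ℝ] ℝ) →L[ℝ] ℝ, _ = Φ (S Ψ)) ↦
    hC.schoutenBracket_eq hC hd hd hf hg hh s₁ s₂ hS hS rfl rfl rfl
  set Φ := fderiv ℝ (f ∘ (extChartAt (cotangentModel E) ξ).symm)
    (extChartAt (cotangentModel E) ξ ξ)
  set Ψ := fderiv ℝ (g ∘ (extChartAt (cotangentModel E) ξ).symm)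
    (extChartAt (cotangentModel E) ξ ξ)
  set Θ := fderiv ℝ (h ∘ (extChartAt (cotangentModel E) ξ).symm)
    (extChartAt (cotangentModel E) ξ ξ)
  rw [extChartAt_cotangent_self] at h1
  set p := ξ.2.comp (chartDerivSymm 𝓘(ℝ, E) ξ.1 ξ.1)
  have h2 := h1 (hP.liftModel_skew p) (hP.liftModel_skew p) _ (hP.liftModel_eq p)
  -- The Schouten bracket of a bivector field with itself counts its Jacobiator twice.
  rw [hP.jacobiator_liftModel p Φ Ψ Θ rfl rfl rfl rfl rfl rfl, ← two_mul, ← map_add,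
    ← map_add] at h2
  exact ⟨_, _, _, _, _, _, h2⟩

/-- `[w^H, W_0]` in canonical coordinates. -/
theorem IsPoissonConnection.schoutenBracket_horizontalLiftTensor_canonicalPoisson
    (hcov : IsPoissonConnection cov w) (hw : IsBivectorField w) (ξ : CotangentBundle E M)
    (hf : ContMDiff (cotangentModel E) 𝓘(ℝ, ℝ) ∞ f)
    (hg : ContMDiff (cotangentModel E) 𝓘(ℝ, ℝ) ∞ g)
    (hh : ContMDiff (cotangentModel E) 𝓘(ℝ, ℝ) ∞ h) {Φ Ψ Θ : E × (E →L[ℝ] ℝ) →L[ℝ] ℝ}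
    (hΦ : fderiv ℝ (f ∘ (extChartAt (cotangentModel E) ξ).symm)
      (extChartAt (cotangentModel E) ξ ξ) = Φ)
    (hΨ : fderiv ℝ (g ∘ (extChartAt (cotangentModel E) ξ).symm)
      (extChartAt (cotangentModel E) ξ ξ) = Ψ)
    (hΘ : fderiv ℝ (h ∘ (extChartAt (cotangentModel E) ξ).symm)
      (extChartAt (cotangentModel E) ξ ξ) = Θ)
    {p : E →L[ℝ] ℝ} (hp : ξ.2.comp (chartDerivSymm 𝓘(ℝ, E) ξ.1 ξ.1) = p) :
    schoutenBracket (horizontalLiftTensor cov w) (canonicalPoisson E M) f g h ξ =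
      p (christoffelCurvature (christoffel cov ξ.1) (extChartAt 𝓘(ℝ, E) ξ.1 ξ.1)
          (verticalPart Ψ) (verticalPart Θ)
          (modelSharp (bivectorInChart w ξ.1 (extChartAt 𝓘(ℝ, E) ξ.1 ξ.1))
            (horizontalPart (christoffel cov ξ.1) (extChartAt 𝓘(ℝ, E) ξ.1 ξ.1, p) Φ)))
      + p (christoffelCurvature (christoffel cov ξ.1) (extChartAt 𝓘(ℝ, E) ξ.1 ξ.1)
          (verticalPart Θ) (verticalPart Φ)
          (modelSharp (bivectorInChart w ξ.1 (extChartAt 𝓘(ℝ, E) ξ.1 ξ.1))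
            (horizontalPart (christoffel cov ξ.1) (extChartAt 𝓘(ℝ, E) ξ.1 ξ.1, p) Ψ)))
      + p (christoffelCurvature (christoffel cov ξ.1) (extChartAt 𝓘(ℝ, E) ξ.1 ξ.1)
          (verticalPart Φ) (verticalPart Ψ)
          (modelSharp (bivectorInChart w ξ.1 (extChartAt 𝓘(ℝ, E) ξ.1 ξ.1))
            (horizontalPart (christoffel cov ξ.1) (extChartAt 𝓘(ℝ, E) ξ.1 ξ.1, p) Θ))) := by
  have hP := hcov.isPoissonChristoffel hw ξ.1
  have hd := (hcov.contDiffAt_liftModel hw ξ).differentiableAt (by simp)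
  have hC := hasChartExpression_horizontalLiftTensor cov w ξ
  have hC' := hasChartExpression_canonicalPoisson hcov.torsion_free ξ
  have skew : ∀ Φ Ψ, canonicalModel E Φ Ψ = -canonicalModel E Ψ Φ := fun Φ Ψ ↦
    (neg_sub _ _).symm
  have h1 := fun s₁ (S : (E × (E →L[ℝ] ℝ) →L[ℝ] ℝ) → E × (E →L[ℝ] ℝ))
      (hS : ∀ Φ Ψ : E × (E →L[ℝ] ℝ) →L[ℝ] ℝ, _ = Φ (S Ψ)) ↦
    hC.schoutenBracket_eq hC' hd (differentiableAt_const _) hf hg hh s₁ skew hS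
      canonicalModel_eq hΦ hΨ hΘ
  rw [extChartAt_cotangent_self, hp] at h1
  rw [h1 (hP.liftModel_skew p) _ (hP.liftModel_eq p),
    hP.schouten_liftModel p Φ Ψ Θ rfl rfl rfl rfl rfl rfl]
  simp

end HorizontalLift

/-! ### The equivalence. -/

theorem proposition3p9 {E : Type*} [NormedAddCommGroup E] [NormedSpace ℝ E]
    [FiniteDimensional ℝ E] {M : Type*} [TopologicalSpace M] [T2Space M] [ChartedSpace E M]
    [IsManifold 𝓘(ℝ, E) ∞ M] (w : ContravariantTwoTensor 𝓘(ℝ, E) M) (hw : IsPoisson w)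
    (hreg : IsRegularBivector w)
    (cov : CovariantDerivative 𝓘(ℝ, E) E (TangentSpace 𝓘(ℝ, E) : M → Type _))
    (hcov : IsPoissonConnection cov w) :
    (IsPoisson (horizontalLiftTensor cov w) ∧
        AreCompatible (horizontalLiftTensor cov w) (canonicalPoisson E M)) ↔
      ∀ α : ∀ y : M, TangentSpace 𝓘(ℝ, E) y →L[ℝ] ℝ, (∀ x, SmoothOneFormAt α x) →
        ∀ X Y : ∀ y : M, TangentSpace 𝓘(ℝ, E) y,
          IsSmoothVectorField X → IsSmoothVectorField Y →
            ∀ x : M, connectionCurvature cov X Y (fun y ↦ bivectorSharp w y (α y)) x = 0 := by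
  have hb := hw.isBivectorField
  rw [forall_connectionCurvature_bivectorSharp_iff hb hcov]
  constructor
  · rintro ⟨-, hc⟩ x u v α
    -- The curvature vector is tested against every covector `p`; the bracket is then evaluated at
    -- the point `ξ` of `T*M` with momentum coordinate `p`.
    refine SeparatingDual.eq_zero_of_forall_dual_eq_zero (R := ℝ) fun p ↦ ?_
    have hx := mem_chart_source E x
    have hp : (p.comp (chartDeriv 𝓘(ℝ, E) x x)).comp (chartDerivSymm 𝓘(ℝ, E) x x) = p := by
      ext b
      exact congrArg p (chartDeriv_chartDerivSymm hx b)
    set G := christoffel cov x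
    set z := extChartAt 𝓘(ℝ, E) x x
    set ξ : CotangentBundle E M := ⟨x, p.comp (chartDeriv 𝓘(ℝ, E) x x)⟩
    -- The differential of `f` is pulled back from the base: its vertical part is `0` and its
    -- horizontal part is `α`.
    obtain ⟨f, hf, hf'⟩ := exists_contMDiff_cotangent_fderiv_eq ξ
      (α.comp (ContinuousLinearMap.fst ℝ E (E →L[ℝ] ℝ)))
    -- the covector with vertical part `b` that vanishes on horizontal vectors
    have vert : ∀ b : E, ∃ Φ : E × (E →L[ℝ] ℝ) →L[ℝ] ℝ, verticalPart Φ = b ∧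
        horizontalPart G (z, p) Φ = 0 := by
      intro b
      -- The first summand gives the vertical part `b`; the second is forced by vanishing on the
      -- lifts `(v, p(G z · v))`.
      set Φ : E × (E →L[ℝ] ℝ) →L[ℝ] ℝ :=
        (ContinuousLinearMap.apply ℝ ℝ b).comp (ContinuousLinearMap.snd ℝ E (E →L[ℝ] ℝ))
          - (p.comp (G z b)).comp (ContinuousLinearMap.fst ℝ E (E →L[ℝ] ℝ)) with hΦ
      have h1 : verticalPart Φ = b := by
        refine (SeparatingDual.eq_iff_forall_dual_eq (R := ℝ)).2 fun q ↦ ?_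
        simp [hΦ]
      refine ⟨Φ, h1, ?_⟩
      ext v
      rw [horizontalPart_apply, h1]
      simp [hΦ]
    obtain ⟨Ψ, hΨ, hΨ'⟩ := vert u
    obtain ⟨Θ, hΘ, hΘ'⟩ := vert v
    obtain ⟨g, hg, hg'⟩ := exists_contMDiff_cotangent_fderiv_eq ξ Ψ
    obtain ⟨h, hh, hh'⟩ := exists_contMDiff_cotangent_fderiv_eq ξ Θ
    have key := hcov.schoutenBracket_horizontalLiftTensor_canonicalPoisson hb ξ hf hg hh
      hf' hg' hh' hp
    have h0 : ∀ B : (E →L[ℝ] ℝ) →L[ℝ] (E →L[ℝ] ℝ) →L[ℝ] ℝ, modelSharp B 0 = 0 := fun B ↦ by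
      simp [modelSharp]
    have h1 : verticalPart (α.comp (ContinuousLinearMap.fst ℝ E (E →L[ℝ] ℝ))) = 0 := by
      refine (SeparatingDual.eq_iff_forall_dual_eq (R := ℝ)).2 fun q ↦ ?_
      simp
    have h2 : horizontalPart G (z, p) (α.comp (ContinuousLinearMap.fst ℝ E (E →L[ℝ] ℝ))) = α := by
      ext v
      rw [horizontalPart_apply, h1]
      simp
    rw [hc f g h hf hg hh ξ] at key
    -- The base point of `ξ` is replaced by `x`, so that the abbreviations `G` and `z` apply.
    change _ = p (christoffelCurvature G z _ _
        (modelSharp (bivectorInChart w x z) (horizontalPart G (z, p) _)))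
      + p (christoffelCurvature G z _ _ (modelSharp _ (horizontalPart G (z, p) _)))
      + p (christoffelCurvature G z _ _ (modelSharp _ (horizontalPart G (z, p) _))) at key
    rw [hΨ, hΘ, hΨ', hΘ', h1, h2, h0] at key
    simpa [christoffelCurvature] using key.symm
  · intro hR
    have hP := hcov.isPoissonChristoffel hb
    refine ⟨⟨hcov.isBivectorField_horizontalLiftTensor hb, fun f g h hf hg hh ξ ↦ ?_⟩,
      fun f g h hf hg hh ξ ↦ ?_⟩
    · obtain ⟨α, β, γ, a, b, c, key⟩ :=
        hcov.schoutenBracket_horizontalLiftTensor_self hb ξ hf hg hh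
      have hz : ∀ (μ ν : E →L[ℝ] ℝ) (a : E),
          christoffelCurvature (christoffel cov ξ.1) (extChartAt 𝓘(ℝ, E) ξ.1 ξ.1)
            (modelSharp (bivectorInChart w ξ.1 (extChartAt 𝓘(ℝ, E) ξ.1 ξ.1)) μ)
            (modelSharp (bivectorInChart w ξ.1 (extChartAt 𝓘(ℝ, E) ξ.1 ξ.1)) ν) a = 0 := by
        intro μ ν a
        -- In the other two terms of the cyclic sum the curvature acts on a vector in the image of
        -- `♯`, so `hR` removes them.
        have h1 := (hP ξ.1).bianchi
          (modelSharp (bivectorInChart w ξ.1 (extChartAt 𝓘(ℝ, E) ξ.1 ξ.1)) μ)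
          (modelSharp (bivectorInChart w ξ.1 (extChartAt 𝓘(ℝ, E) ξ.1 ξ.1)) ν) a
        rwa [hR, hR, add_zero, add_zero] at h1
      rw [hz, hz, hz] at key
      unfold schoutenBracket at key
      simp only [add_zero, map_zero, mul_zero] at key
      linarith
    · rw [hcov.schoutenBracket_horizontalLiftTensor_canonicalPoisson hb ξ hf hg hh rfl rfl rfl rfl,
        hR, hR, hR]
      simp

end
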